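/- Let $X$ be a measurable space with a quasimetric $d$ (that is, $d\ge 0$, $d(x,y)=0$ iff $x=y$, $d$ is symmetric, and $d(x,y)\le K\,(d(x,z)+d(z,y))$ with a constant $K$), measurable on $X\times X$, and let $\mu$ be a measure on $X$. Write $B(x,r)=\{y\in X: d(x,y)<r\}$. Suppose that $0<\mu B(x,r)<\infty$ for all $x\in X$, $r>0$, that $\mu$ is doubling, i.e. $\mu B(x,2r)\le C\mu B(x,r)$ for all $x\in X$, $r>0$ with a constant $C$, and that $X$ is bounded, i.e. $\sup_{x,y}d(x,y)<\infty$. Let $p:X\to\mathbb{R}$ be measurable with $1<p_-:=\inf_X p\le p^+:=\sup_X p<\infty$ and log-Hölder continuous: for some constant $A$, $$|p(x)-p(y)|\le \frac{A}{\ln\frac{1}{d(x,y)}}\qquad\text{whenever } x\neq y,\ d(x,y)\le \tfrac12 .$$ For a weight $\varrho$ (a measurable function $\varrho:X\to[0,\infty)$, positive almost everywhere) let $L^{p(\cdot)}(X,\varrho)$ be the space of measurable $f:X\to\mathbb{C}$ with $$\|f\|_{L^{p(\cdot)}(X,\varrho)}=\inf\Big\{\lambda>0:\int_X\Big|\frac{\varrho(x)f(x)}{\lambda}\Big|^{p(x)}d\mu(x)\le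 1\Big\}<\infty ,$$ and let $\mathcal{M}f(x)=\sup_{r>0}\frac{1}{\mu B(x,r)}\int_{B(x,r)}|f(y)|\,d\mu(y)$ be the Hardy–Littlewood maximal operator. **Theorem A.** If the weight $\varrho$ satisfies $$\sup_{x\in X,\ r>0}\Big(\frac{1}{\mu B(x,r)}\int_{B(x,r)}\varrho(y)^{p(y)}\,d\mu(y)\Big)\Big(\frac{1}{\mu B(x,r)}\int_{B(x,r)}\frac{d\mu(y)}{\varrho(y)^{p(y)/(p_--1)}}\Big)^{p_--1}<\infty ,$$ then $\mathcal{M}$ is bounded in $L^{p(\cdot)}(X,\varrho)$: there is a constant $C$ such that for every $f\in L^{p(\cdot)}(X,\varrho)$ the function $\mathcal{M}f$ is finite almost everywhere, belongs to $L^{p(\cdot)}(X,\varrho)$, and $\|\mathcal{M}f\|_{L^{p(\cdot)}(X,\varrho)}\le C\,\|f\|_{L^{p(\cdot)}(X,\varrho)}$. Equivalently, the class $\widetilde{\mathcal{A}}_{p(\cdot)}(X)$ of weights satisfying the displayed condition is contained in the class $\mathcal{A}_{p(\cdot)}(X)$ of weights for which $\mathcal{M}$ is bounded in $L^{p(\cdot)}(X,\varrho)$.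 -/

import Mathlib

open MeasureTheory Set
open scoped ENNReal NNReal

namespace VarExp

/-- `d` is a quasimetric on `X`: the triangle inequality holds up to a constant factor. -/
structure IsQuasimetric {X : Type*} (d : X → X → ℝ) : Prop where
  nonneg : ∀ x y, 0 ≤ d x y
  eq_zero_iff : ∀ x y, d x y = 0 ↔ x = y
  symm : ∀ x y, d x y = d y x
  triangle : ∃ K : ℝ, ∀ x y z, d x y ≤ K * (d x z + d z y)

/-- The ball `B(x, r) = {y | d(x, y) < r}`. -/
def qball {X : Type*} (d : X → X → ℝ) (x : X) (r : ℝ) : Set X :=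
  {y | d x y < r}

/-- `(X, d, μ)` is a (quasi)metric measure space with doubling measure. Joint measurability of `d`
makes all balls and all maximal functions measurable; when `d` is a metric and balls are
measurable it follows from the other conditions. -/
structure IsDoublingSpace {X : Type*} [MeasurableSpace X] (d : X → X → ℝ) (μ : Measure X) :
    Prop where
  quasimetric : IsQuasimetric d
  measurable_dist : Measurable (fun z : X × X => d z.1 z.2)
  measure_ball_pos : ∀ x r, 0 < r → 0 < μ (qball d x r)
  measure_ball_lt_top : ∀ x r, 0 < r → μ (qball d x r) < ∞
  doubling : ∃ C : ℝ≥0, ∀ x r, 0 < r → μ (qball d x (2 * r)) ≤ C * μ (qball d x r)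

/-- The space is bounded: its diameter is finite. -/
def IsBoundedSpace {X : Type*} (d : X → X → ℝ) : Prop :=
  ∃ R : ℝ, ∀ x y, d x y ≤ R

/-- `p₋ = inf p`. -/
noncomputable def pMinus {X : Type*} (p : X → ℝ) : ℝ := ⨅ x, p x

/-- The class `ℙ(X)` of exponents: measurable, `1 < p₋ ≤ p ≤ p⁺ < ∞`, and log-Hölder continuous. -/
structure IsExponent {X : Type*} [MeasurableSpace X] (d : X → X → ℝ) (p : X → ℝ) : Prop where
  measurable : Measurable p
  one_lt_pMinus : 1 < pMinus p
  bddAbove : BddAbove (range p)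
  logHolder : ∃ A : ℝ, ∀ x y, x ≠ y → d x y ≤ 1 / 2 → |p x - p y| ≤ A / Real.log (1 / d x y)

/-- The Luxemburg norm `‖f‖_{p(·)}`, with value `∞` when no `t` is admissible. -/
noncomputable def luxNorm {X : Type*} [MeasurableSpace X] (μ : Measure X) (p : X → ℝ)
    (f : X → ℂ) : ℝ≥0∞ :=
  ⨅ (t : ℝ≥0) (_ : 0 < t) (_ : ∫⁻ x, (‖f x‖ₑ / (t : ℝ≥0∞)) ^ p x ∂μ ≤ 1), (t : ℝ≥0∞)

/-- The weighted norm `‖f‖_{L^{p(·)}(X, ρ)} = ‖ρ f‖_{p(·)}`. -/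
noncomputable def weightedNorm {X : Type*} [MeasurableSpace X] (μ : Measure X) (p ρ : X → ℝ)
    (f : X → ℂ) : ℝ≥0∞ :=
  luxNorm μ p (fun x => (ρ x : ℂ) * f x)

/-- `f ∈ L^{p(·)}(X, ρ)`. -/
def MemWeightedLp {X : Type*} [MeasurableSpace X] (μ : Measure X) (p ρ : X → ℝ)
    (f : X → ℂ) : Prop :=
  AEMeasurable f μ ∧ weightedNorm μ p ρ f < ∞

/-- The (centered) Hardy–Littlewood maximal function. -/
noncomputable def maximal {X : Type*} [MeasurableSpace X] (d : X → X → ℝ) (μ : Measure X)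
    (f : X → ℂ) (x : X) : ℝ≥0∞ :=
  ⨆ (r : ℝ) (_ : 0 < r), (μ (qball d x r))⁻¹ * ∫⁻ y in qball d x r, ‖f y‖ₑ ∂μ

/-- The maximal operator is bounded in `L^{p(·)}(X, ρ)`: for `f` in the space, `M f` is finite
almost everywhere, belongs to the space, and `‖M f‖ ≤ C ‖f‖`. -/
def MaximalBounded {X : Type*} [MeasurableSpace X] (d : X → X → ℝ) (μ : Measure X)
    (p ρ : X → ℝ) : Prop :=
  ∃ C : ℝ≥0, ∀ f : X → ℂ, MemWeightedLp μ p ρ f →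
    (∀ᵐ x ∂μ, maximal d μ f x < ∞) ∧
    MemWeightedLp μ p ρ (fun x => ((maximal d μ f x).toReal : ℂ)) ∧
    weightedNorm μ p ρ (fun x => ((maximal d μ f x).toReal : ℂ)) ≤ C * weightedNorm μ p ρ f

/-- A weight: a measurable, nonnegative, almost everywhere positive function. -/
structure IsWeight {X : Type*} [MeasurableSpace X] (μ : Measure X) (ρ : X → ℝ) : Prop where
  aemeasurable : AEMeasurable ρ μ
  nonneg : ∀ x, 0 ≤ ρ x
  pos : ∀ᵐ x ∂μ, 0 < ρ x

/-- The Muckenhoupt-like condition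
`sup (μB⁻¹ ∫_B ρ^{p(y)}) (μB⁻¹ ∫_B ρ^{-p(y)/(p₋ - 1)})^{p₋ - 1} < ∞`, over all balls `B`. -/
def MuckenhouptLike {X : Type*} [MeasurableSpace X] (d : X → X → ℝ) (μ : Measure X)
    (p ρ : X → ℝ) : Prop :=
  (⨆ (x : X) (r : ℝ) (_ : 0 < r),
    ((μ (qball d x r))⁻¹ * ∫⁻ y in qball d x r, ENNReal.ofReal (ρ y) ^ p y ∂μ) *
    ((μ (qball d x r))⁻¹ *
      ∫⁻ y in qball d x r, (ENNReal.ofReal (ρ y) ^ (p y / (pMinus p - 1)))⁻¹ ∂μ)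
        ^ (pMinus p - 1)) < ∞

/-- The class `Ã_{p(·)}(X)` of weights. -/
def tildeA {X : Type*} [MeasurableSpace X] (d : X → X → ℝ) (μ : Measure X) (p : X → ℝ) :
    Set (X → ℝ) :=
  {ρ | IsWeight μ ρ ∧ MuckenhouptLike d μ p ρ}

/-- The class `A_{p(·)}(X)` of weights. -/
def classA {X : Type*} [MeasurableSpace X] (d : X → X → ℝ) (μ : Measure X) (p : X → ℝ) :
    Set (X → ℝ) :=
  {ρ | IsWeight μ ρ ∧ MaximalBounded d μ p ρ}

end VarExp

/-!
The exponent in the Muckenhoupt-like condition is tailored so that the condition says exactly that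
`w = ρ ^ p` belongs to the classical class `A_q` for the constant exponent `q = p₋`. The proof
combines the constant-exponent theorem for `w` with a pointwise estimate that trades the variable
exponent for the constant one.

*Constant exponent.* Hölder's inequality and the `A_q` condition make both `w μ` and `σ μ` doubling,
where `σ = w ^ (-1 / (q - 1))` is the dual weight. The centered maximal operator of any doubling
measure `ν` is bounded on `L^s(ν)`, `s > 1`: the weak type `(1, 1)` inequality comes from the Vitali
covering lemma (`IsDoublingSpace.weak_type`), the strong type inequality from the layer-cake formula
(`IsDoublingSpace.strong_type`). Following Lerner, the `A_q` condition gives pointwise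
`(M g) ^ (q - 1) ≤ C M_w ((M_σ (g / σ)) ^ (q - 1) / w)`
(`IsMuckenhouptWeight.exists_ballMaximal_rpow_le`), and the bounds for `M_w` on `L^{q'}(w)` and
`M_σ` on `L^q(σ)` give Muckenhoupt's theorem
(`IsMuckenhouptWeight.exists_lintegral_ballMaximal_le`). No self-improvement of `A_q`, no
differentiation theorem and no interpolation theorem are needed.

*Variable exponent.* Let `s = p / q ≥ 1` and `∫ g ^ p w ≤ 1`. Since `μ` and `σ μ` are finite,
`∫ g ^ s ≤ ∫ (g ^ p w + σ)` is bounded by a fixed constant, so the averages of `g ^ s` on a ball `B`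
are at most `D / μ B`. In a bounded doubling space `μ B ≥ c r ^ L`, and by log-Hölder continuity the
exponent oscillates on `B` by at most `δ = A / log (1 / r)`, so that `(D / μ B) ^ δ` is bounded.
Jensen's inequality with the exponent `max 1 (s x - δ)` then gives `(M g) ^ s ≤ C (M (g ^ s) + 1)`
(`IsDoublingSpace.exists_ballMaximal_rpow_le`). Raising this to the power `q`, integrating against
`w` and using Muckenhoupt's theorem yields the modular bound
(`IsMuckenhouptWeight.exists_modular_bound`), which passes to the norm by homogeneity.
-/

namespace VarExp

/-! ### Doubling spaces -/

section Doubling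

variable {X : Type*} {d : X → X → ℝ}

lemma IsQuasimetric.exists_one_le (h : IsQuasimetric d) :
    ∃ K : ℝ, 1 ≤ K ∧ ∀ x y z, d x y ≤ K * (d x z + d z y) := by
  obtain ⟨K, hK⟩ := h.triangle
  refine ⟨max K 1, le_max_right _ _, fun x y z => (hK x y z).trans ?_⟩
  have := h.nonneg x z
  have := h.nonneg z y
  gcongr
  exact le_max_left _ _

lemma IsQuasimetric.mem_qball_self (h : IsQuasimetric d) (x : X) {r : ℝ} (hr : 0 < r) :
    x ∈ qball d x r := by
  change d x x < r
  rwa [(h.eq_zero_iff x x).2 rfl]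

lemma qball_mono (d : X → X → ℝ) (x : X) {r s : ℝ} (h : r ≤ s) : qball d x r ⊆ qball d x s :=
  fun _ hy => lt_of_lt_of_le hy h

lemma qball_eq_univ {R r : ℝ} (hR : ∀ x y, d x y ≤ R) (h : R < r) (x : X) :
    qball d x r = univ :=
  eq_univ_of_forall fun y => (hR x y).trans_lt h

variable [MeasurableSpace X] {μ : Measure X}

lemma measurableSet_qball (hd : Measurable fun z : X × X => d z.1 z.2) (x : X) (r : ℝ) :
    MeasurableSet (qball d x r) :=
  measurableSet_lt (hd.comp measurable_prodMk_left) measurable_const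

lemma IsDoublingSpace.measurableSet_qball (h : IsDoublingSpace d μ) (x : X) (r : ℝ) :
    MeasurableSet (qball d x r) :=
  VarExp.measurableSet_qball h.measurable_dist x r

lemma IsDoublingSpace.measure_univ_lt_top (h : IsDoublingSpace d μ) (hb : IsBoundedSpace d) :
    μ univ < ∞ := by
  obtain ⟨R, hR⟩ := hb
  rcases isEmpty_or_nonempty X with hX | ⟨⟨x⟩⟩
  · simp [univ_eq_empty_iff.2 hX]
  · have := h.measure_ball_lt_top x (max R 0 + 1) (by positivity)
    rwa [qball_eq_univ hR (by linarith [le_max_left R 0]) x] at this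

lemma IsDoublingSpace.isFiniteMeasure (h : IsDoublingSpace d μ) (hb : IsBoundedSpace d) :
    IsFiniteMeasure μ :=
  ⟨h.measure_univ_lt_top hb⟩

lemma measure_qball_two_pow_le {C : ℝ≥0}
    (hC : ∀ x r, 0 < r → μ (qball d x (2 * r)) ≤ C * μ (qball d x r)) (n : ℕ) (x : X) (r : ℝ)
    (hr : 0 < r) : μ (qball d x (2 ^ n * r)) ≤ (C : ℝ≥0∞) ^ n * μ (qball d x r) := by
  induction n with
  | zero => simp
  | succ n ih =>
    calc μ (qball d x (2 ^ (n + 1) * r)) = μ (qball d x (2 * (2 ^ n * r))) := by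
          rw [pow_succ]; ring_nf
      _ ≤ C * μ (qball d x (2 ^ n * r)) := hC _ _ (by positivity)
      _ ≤ C * ((C : ℝ≥0∞) ^ n * μ (qball d x r)) := by gcongr
      _ = _ := by rw [pow_succ]; ring

lemma IsDoublingSpace.exists_dilation (h : IsDoublingSpace d μ) (κ : ℝ) :
    ∃ C : ℝ≥0, ∀ x r, 0 < r → μ (qball d x (κ * r)) ≤ C * μ (qball d x r) := by
  obtain ⟨C, hC⟩ := h.doubling
  obtain ⟨n, hn⟩ := pow_unbounded_of_one_lt κ (one_lt_two (α := ℝ))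
  refine ⟨C ^ n, fun x r hr => ?_⟩
  refine (measure_mono (qball_mono d x (s := 2 ^ n * r) (by gcongr))).trans ?_
  simpa using measure_qball_two_pow_le hC n x r hr

end Doubling

/-! ### The centered maximal operator of a doubling measure -/

section Maximal

variable {X : Type*} [MeasurableSpace X] {d : X → X → ℝ} {ν : Measure X}

/-- The centered maximal operator over `d`-balls of a measure `ν`, acting on functions with values
in `[0, ∞]`; `maximal d μ f` is its value at `‖f‖ₑ` for `ν = μ`. -/
noncomputable def ballMaximal (d : X → X → ℝ) (ν : Measure X) (g : X → ℝ≥0∞) (x : X) : ℝ≥0∞ :=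
  ⨆ (r : ℝ) (_ : 0 < r), (ν (qball d x r))⁻¹ * ∫⁻ y in qball d x r, g y ∂ν

lemma average_le_ballMaximal (g : X → ℝ≥0∞) (x : X) {r : ℝ} (hr : 0 < r) :
    (ν (qball d x r))⁻¹ * ∫⁻ y in qball d x r, g y ∂ν ≤ ballMaximal d ν g x :=
  le_iSup₂ (f := fun (r : ℝ) (_ : 0 < r) => (ν (qball d x r))⁻¹ * ∫⁻ y in qball d x r, g y ∂ν) r hr

lemma ballMaximal_congr_ae {g h : X → ℝ≥0∞} (hgh : g =ᵐ[ν] h) :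
    ballMaximal d ν g = ballMaximal d ν h := by
  funext x
  have (r : ℝ) : ∫⁻ y in qball d x r, g y ∂ν = ∫⁻ y in qball d x r, h y ∂ν :=
    lintegral_congr_ae (ae_restrict_of_ae hgh)
  simp only [ballMaximal, this]

lemma ballMaximal_const_mul {c : ℝ≥0∞} (hc : c ≠ ∞) (g : X → ℝ≥0∞) (x : X) :
    ballMaximal d ν (fun y => c * g y) x = c * ballMaximal d ν g x := by
  simp only [ballMaximal, lintegral_const_mul' _ _ hc, ENNReal.mul_iSup, mul_left_comm c]

/-- Only rational radii matter, because the centered balls increase continuously from the left. -/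
lemma ballMaximal_eq_iSup_rat (d : X → X → ℝ) (ν : Measure X) (g : X → ℝ≥0∞) (x : X) :
    ballMaximal d ν g x = ⨆ (q : ℚ) (_ : (0 : ℝ) < q),
      (ν (qball d x q))⁻¹ * ∫⁻ y in qball d x q, g y ∂ν := by
  refine le_antisymm (iSup₂_le fun r hr => ?_)
    (iSup₂_le fun q hq => average_le_ballMaximal g x hq)
  have hU : qball d x r = ⋃ q : {q : ℚ // (0 : ℝ) < q ∧ (q : ℝ) < r}, qball d x q := by
    ext y
    simp only [mem_iUnion, qball, mem_ofPred_eq]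
    constructor
    · intro hy
      obtain ⟨q, hq1, hq2⟩ := exists_rat_btwn (max_lt hy hr)
      exact ⟨⟨q, (le_max_right _ _).trans_lt hq1, hq2⟩, (le_max_left _ _).trans_lt hq1⟩
    · rintro ⟨⟨q, hq1, hq2⟩, hy⟩
      exact hy.trans hq2
  have hdir : Directed (· ⊆ ·)
      fun q : {q : ℚ // (0 : ℝ) < q ∧ (q : ℝ) < r} => qball d x q :=
    directed_of_isDirected_le fun a b hab => qball_mono d x (by exact_mod_cast hab)
  conv_lhs => rw [hU, setLIntegral_iUnion_of_directed _ hdir, ENNReal.mul_iSup]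
  refine iSup_le fun q => ?_
  refine le_trans ?_ (le_iSup₂ (f := fun (q : ℚ) (_ : (0 : ℝ) < q) =>
    (ν (qball d x q))⁻¹ * ∫⁻ y in qball d x q, g y ∂ν) q.1 q.2.1)
  gcongr
  exact subset_iUnion (fun q : {q : ℚ // (0 : ℝ) < q ∧ (q : ℝ) < r} => qball d x q) q

lemma measurable_setLIntegral_qball [SFinite ν] (hd : Measurable fun z : X × X => d z.1 z.2)
    {g : X → ℝ≥0∞} (hg : Measurable g) (r : ℝ) :
    Measurable fun x => ∫⁻ y in qball d x r, g y ∂ν := by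
  have hs : MeasurableSet {z : X × X | d z.1 z.2 < r} := measurableSet_lt hd measurable_const
  have := ((hg.comp measurable_snd).indicator hs).lintegral_prod_right' (ν := ν)
  convert this using 2 with x
  rw [← lintegral_indicator (measurableSet_qball hd x r)]
  rfl

lemma measurable_ballMaximal [SFinite ν] (hd : Measurable fun z : X × X => d z.1 z.2)
    {g : X → ℝ≥0∞} (hg : Measurable g) : Measurable (ballMaximal d ν g) := by
  have : ballMaximal d ν g = fun x => ⨆ (q : ℚ) (_ : (0 : ℝ) < q),
      (ν (qball d x q))⁻¹ * ∫⁻ y in qball d x q, g y ∂ν :=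
    funext (ballMaximal_eq_iSup_rat d ν g)
  rw [this]
  refine Measurable.iSup fun q => Measurable.iSup fun _ => ?_
  refine Measurable.mul (Measurable.inv ?_) (measurable_setLIntegral_qball hd hg q)
  simpa using measurable_setLIntegral_qball (ν := ν) hd (measurable_const (a := (1 : ℝ≥0∞))) q

/-- The weak type `(1, 1)` inequality, from the Vitali covering lemma. -/
theorem IsDoublingSpace.weak_type (h : IsDoublingSpace d ν) (hb : IsBoundedSpace d) :
    ∃ C : ℝ≥0, ∀ (g : X → ℝ≥0∞) (l : ℝ≥0∞),
      l * ν {x | l < ballMaximal d ν g x} ≤ C * ∫⁻ x, g x ∂ν := by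
  have := h.isFiniteMeasure hb
  obtain ⟨R, hR⟩ := hb
  obtain ⟨K, hK1, hK⟩ := h.quasimetric.exists_one_le
  obtain ⟨C, hC⟩ := h.exists_dilation (3 * K)
  refine ⟨C, fun g l => ?_⟩
  -- Radii above the diameter give the same ball, so bounded radii suffice for the covering lemma.
  have key : ∀ x ∈ {x | l < ballMaximal d ν g x}, ∃ r : ℝ, 0 < r ∧ r ≤ max R 0 + 1 ∧
      l * ν (qball d x r) ≤ ∫⁻ y in qball d x r, g y ∂ν := by
    intro x hx
    simp only [ballMaximal, mem_ofPred_eq, lt_iSup_iff] at hx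
    obtain ⟨r, hr, hlr⟩ := hx
    have hB : qball d x (min r (max R 0 + 1)) = qball d x r := by
      rcases min_choice r (max R 0 + 1) with h1 | h1
      · rw [h1]
      · have h2 : R < max R 0 + 1 := by linarith [le_max_left R 0]
        rw [h1, qball_eq_univ hR h2 x,
          qball_eq_univ hR (h2.trans_le (by rw [← h1]; exact min_le_left _ _)) x]
    refine ⟨min r (max R 0 + 1), lt_min hr (by positivity), min_le_right _ _, ?_⟩
    rw [hB]
    have h0 := (h.measure_ball_pos x r hr).ne'
    have ht := (h.measure_ball_lt_top x r hr).ne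
    calc l * ν (qball d x r)
        ≤ (ν (qball d x r))⁻¹ * (∫⁻ y in qball d x r, g y ∂ν) * ν (qball d x r) := by gcongr
      _ = (ν (qball d x r))⁻¹ * ν (qball d x r) * ∫⁻ y in qball d x r, g y ∂ν := by ring
      _ = _ := by rw [ENNReal.inv_mul_cancel h0 ht, one_mul]
  choose! ρ hρ0 hρR hρ using key
  obtain ⟨u, hut, hdisj, hcov⟩ := Vitali.exists_disjoint_subfamily_covering_enlargement
    (fun x => qball d x (ρ x)) {x | l < ballMaximal d ν g x} ρ 2 one_lt_two
    (fun x hx => (hρ0 x hx).le) _ hρR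
    (fun x hx => ⟨x, h.quasimetric.mem_qball_self x (hρ0 x hx)⟩)
  have hcount : u.Countable := by
    have := Measure.countable_meas_pos_of_disjoint_iUnion (μ := ν)
      (As := fun x : u => qball d x.1 (ρ x.1)) (fun x => h.measurableSet_qball _ _)
      (fun a b hab => hdisj a.2 b.2 (fun e => hab (Subtype.ext e)))
    have h2 : {x : u | 0 < ν (qball d x.1 (ρ x.1))} = univ :=
      eq_univ_of_forall fun x => h.measure_ball_pos _ _ (hρ0 _ (hut x.2))
    rw [h2] at this
    exact countable_coe_iff.1 (countable_univ_iff.1 this)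
  have hsub : {x | l < ballMaximal d ν g x} ⊆
      ⋃ b ∈ u, qball d b (3 * K * ρ b) := by
    intro a ha
    obtain ⟨b, hbu, ⟨z, hza, hzb⟩, hab⟩ := hcov a ha
    refine mem_biUnion hbu ?_
    have h1 : d b z < ρ b := hzb
    have h2 : d a z < ρ a := hza
    have h3 := hK b a z
    rw [h.quasimetric.symm z a] at h3
    have hb0 := hρ0 b (hut hbu)
    change d b a < _
    have h4 : d b z + d a z < 3 * ρ b := by linarith
    calc d b a ≤ K * (d b z + d a z) := h3
      _ < K * (3 * ρ b) := by gcongr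
      _ = _ := by ring
  calc l * ν {x | l < ballMaximal d ν g x}
      ≤ l * ν (⋃ b ∈ u, qball d b (3 * K * ρ b)) := by gcongr
    _ ≤ l * ∑' b : u, ν (qball d b (3 * K * ρ b)) := by
        gcongr; exact measure_biUnion_le ν hcount _
    _ ≤ l * ∑' b : u, C * ν (qball d b (ρ b)) := by
        gcongr with b; exact hC _ _ (hρ0 _ (hut b.2))
    _ = C * ∑' b : u, l * ν (qball d b (ρ b)) := by
        rw [ENNReal.tsum_mul_left, ENNReal.tsum_mul_left]; ring
    _ ≤ C * ∑' b : u, ∫⁻ y in qball d b (ρ b), g y ∂ν := by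
        gcongr with b; exact hρ _ (hut b.2)
    _ = C * ∫⁻ y in ⋃ b ∈ u, qball d b (ρ b), g y ∂ν := by
        rw [lintegral_biUnion hcount (fun b _ => h.measurableSet_qball _ _) hdisj]
    _ ≤ C * ∫⁻ y, g y ∂ν := by gcongr; exact Measure.restrict_le_self

end Maximal

section StrongType

variable {X : Type*} [MeasurableSpace X] {d : X → X → ℝ} {ν : Measure X}

lemma rpow_eq_mul_rpow_sub_one (a : ℝ≥0∞) {s : ℝ} (hs : 1 ≤ s) : a ^ s = a * a ^ (s - 1) := by
  nth_rewrite 2 [← ENNReal.rpow_one a]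
  rw [← ENNReal.rpow_add_of_nonneg _ _ zero_le_one (by linarith)]
  congr 1
  ring

/-- The layer-cake formula for a single power, valid also at `a = ∞`. -/
lemma ofReal_mul_lintegral_indicator_rpow {s : ℝ} (hs : 0 < s) (a : ℝ≥0∞) :
    ENNReal.ofReal s * ∫⁻ t in Ioi (0 : ℝ),
      {t : ℝ | ENNReal.ofReal t < a}.indicator (fun t => ENNReal.ofReal t ^ (s - 1)) t = a ^ s := by
  have key (b : ℝ) (hb : 0 ≤ b) : ENNReal.ofReal s * ∫⁻ t in Ioi (0 : ℝ),
      {t : ℝ | ENNReal.ofReal t < ENNReal.ofReal b}.indicator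
        (fun t => ENNReal.ofReal t ^ (s - 1)) t = ENNReal.ofReal b ^ s := by
    have hset : MeasurableSet {t : ℝ | ENNReal.ofReal t < ENNReal.ofReal b} :=
      measurableSet_lt ENNReal.measurable_ofReal measurable_const
    rw [lintegral_indicator hset, Measure.restrict_restrict hset]
    have hI : {t : ℝ | ENNReal.ofReal t < ENNReal.ofReal b} ∩ Ioi 0 = Ioo 0 b := by
      ext t
      simp only [mem_inter_iff, mem_ofPred_eq, mem_Ioi, mem_Ioo, ENNReal.ofReal_lt_ofReal_iff']
      constructor
      · rintro ⟨⟨h1, -⟩, h3⟩; exact ⟨h3, h1⟩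
      · rintro ⟨h1, h2⟩; exact ⟨⟨h2, h1.trans h2⟩, h1⟩
    have hint : IntegrableOn (fun t : ℝ => t ^ (s - 1)) (Ioc 0 b) := by
      rw [← intervalIntegrable_iff_integrableOn_Ioc_of_le hb]
      exact intervalIntegral.intervalIntegrable_rpow' (by linarith)
    rw [hI, setLIntegral_congr_fun (g := fun t => ENNReal.ofReal (t ^ (s - 1))) measurableSet_Ioo
      (fun t ht => ENNReal.ofReal_rpow_of_pos ht.1), setLIntegral_congr Ioo_ae_eq_Ioc,
      ← ofReal_integral_eq_lintegral_ofReal hint, ← intervalIntegral.integral_of_le hb,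
      integral_rpow (Or.inl (by linarith)), ← ENNReal.ofReal_mul hs.le,
      ENNReal.ofReal_rpow_of_nonneg hb hs.le]
    · congr 1
      rw [sub_add_cancel, Real.zero_rpow hs.ne']
      field_simp
      ring
    · filter_upwards [ae_restrict_mem measurableSet_Ioc] with t ht
      exact Real.rpow_nonneg ht.1.le _
  rcases eq_or_ne a ∞ with rfl | ha
  · rw [ENNReal.top_rpow_of_pos hs]
    refine ENNReal.eq_top_of_forall_nnreal_le fun c => ?_
    have hc : (c : ℝ≥0∞) = ENNReal.ofReal ((c : ℝ) ^ s⁻¹) ^ s := by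
      rw [ENNReal.ofReal_rpow_of_nonneg (by positivity) hs.le,
        Real.rpow_inv_rpow c.coe_nonneg hs.ne', ENNReal.ofReal_coe_nnreal]
    rw [hc, ← key _ (by positivity)]
    refine mul_le_mul' le_rfl (lintegral_mono fun t => ?_)
    exact indicator_le_indicator_of_subset (fun t _ => ENNReal.ofReal_lt_top)
      (fun t => zero_le (a := ENNReal.ofReal t ^ (s - 1))) t
  · lift a to ℝ≥0 using ha
    simpa using key a a.2

lemma measurable_indicator_lt_rpow {g : X → ℝ≥0∞} (hg : Measurable g) (s : ℝ) :
    Measurable fun z : X × ℝ =>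
      {t : ℝ | ENNReal.ofReal t < g z.1}.indicator (fun t => ENNReal.ofReal t ^ s) z.2 := by
  have hS : MeasurableSet {z : X × ℝ | ENNReal.ofReal z.2 < g z.1} :=
    measurableSet_lt (ENNReal.measurable_ofReal.comp measurable_snd) (hg.comp measurable_fst)
  exact (((ENNReal.measurable_ofReal.comp measurable_snd).pow_const s).indicator hS : Measurable
    ({z : X × ℝ | ENNReal.ofReal z.2 < g z.1}.indicator fun z => ENNReal.ofReal z.2 ^ s))

/-- The layer-cake formula for `∫ h g ^ s`, with a density `h`. -/
lemma lintegral_mul_rpow_eq [SFinite ν] {g h : X → ℝ≥0∞} (hg : Measurable g) (hh : Measurable h)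
    {s : ℝ} (hs : 0 < s) :
    ∫⁻ x, h x * g x ^ s ∂ν = ENNReal.ofReal s * ∫⁻ t in Ioi (0 : ℝ),
      ENNReal.ofReal t ^ (s - 1) * ∫⁻ x in {x | ENNReal.ofReal t < g x}, h x ∂ν := by
  have hm := measurable_indicator_lt_rpow hg (s - 1)
  calc ∫⁻ x, h x * g x ^ s ∂ν
      = ∫⁻ x, (ENNReal.ofReal s * ∫⁻ t in Ioi (0 : ℝ), h x *
          {t : ℝ | ENNReal.ofReal t < g x}.indicator (fun t => ENNReal.ofReal t ^ (s - 1)) t) ∂ν := by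
        refine lintegral_congr fun x => ?_
        have : Measurable fun t : ℝ =>
            {t : ℝ | ENNReal.ofReal t < g x}.indicator (fun t => ENNReal.ofReal t ^ (s - 1)) t :=
          hm.comp measurable_prodMk_left
        rw [lintegral_const_mul _ this, mul_left_comm,
          ofReal_mul_lintegral_indicator_rpow hs]
    _ = ENNReal.ofReal s * ∫⁻ t in Ioi (0 : ℝ), ∫⁻ x, h x *
          {t : ℝ | ENNReal.ofReal t < g x}.indicator (fun t => ENNReal.ofReal t ^ (s - 1)) t ∂ν := by
        rw [lintegral_const_mul' _ _ ENNReal.ofReal_ne_top, lintegral_lintegral_swap]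
        exact ((hh.comp measurable_fst).mul hm).aemeasurable
    _ = _ := by
        congr 1
        refine setLIntegral_congr_fun measurableSet_Ioi fun t ht => ?_
        have hS : MeasurableSet {x | ENNReal.ofReal t < g x} := measurableSet_lt measurable_const hg
        have ht' : ENNReal.ofReal t ^ (s - 1) ≠ ∞ := by
          have : 0 < t := ht
          rw [ENNReal.ofReal_rpow_of_pos this]
          exact ENNReal.ofReal_ne_top
        rw [← lintegral_const_mul' _ _ ht', ← lintegral_indicator hS]
        refine lintegral_congr fun x => ?_
        by_cases hx : ENNReal.ofReal t < g x <;> simp [indicator, hx, mul_comm]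

lemma ballMaximal_le_add_const {g h : X → ℝ≥0∞} {c : ℝ≥0∞} (hgh : ∀ x, g x ≤ h x + c) (x : X) :
    ballMaximal d ν g x ≤ ballMaximal d ν h x + c := by
  refine iSup₂_le fun r hr => ?_
  calc (ν (qball d x r))⁻¹ * ∫⁻ y in qball d x r, g y ∂ν
      ≤ (ν (qball d x r))⁻¹ * ∫⁻ y in qball d x r, (h y + c) ∂ν := by gcongr with y; exact hgh y
    _ = (ν (qball d x r))⁻¹ * (∫⁻ y in qball d x r, h y ∂ν)
          + c * ((ν (qball d x r))⁻¹ * ν (qball d x r)) := by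
        rw [lintegral_add_right _ measurable_const, setLIntegral_const]; ring
    _ ≤ ballMaximal d ν h x + c * 1 := by
        gcongr
        · exact average_le_ballMaximal h x hr
        · exact ENNReal.inv_mul_le_one _
    _ = _ := by rw [mul_one]

/-- The maximal operator of a doubling measure is bounded on `L^s` for `s > 1`. The level set
`{t < M g}` is controlled by the weak type inequality for the part of `g` above `t / 2`. -/
theorem IsDoublingSpace.strong_type (h : IsDoublingSpace d ν) (hb : IsBoundedSpace d) {s : ℝ}
    (hs : 1 < s) : ∃ C : ℝ≥0, ∀ g : X → ℝ≥0∞, Measurable g →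
      ∫⁻ x, ballMaximal d ν g x ^ s ∂ν ≤ C * ∫⁻ x, g x ^ s ∂ν := by
  have := h.isFiniteMeasure hb
  obtain ⟨C, hC⟩ := h.weak_type hb
  have hs1 : 0 < s - 1 := by linarith
  refine ⟨s.toNNReal * (2 * C) * ((s - 1).toNNReal⁻¹ * 2 ^ (s - 1)), fun g hg => ?_⟩
  have hM := measurable_ballMaximal (ν := ν) h.measurable_dist hg
  have hlevel (t : ℝ) (ht : 0 < t) : ENNReal.ofReal t * ν {x | ENNReal.ofReal t < ballMaximal d ν g x}
      ≤ 2 * C * ∫⁻ x in {x | ENNReal.ofReal t < 2 * g x}, g x ∂ν := by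
    have hS : MeasurableSet {x | ENNReal.ofReal t < 2 * g x} :=
      measurableSet_lt measurable_const (hg.const_mul 2)
    have hle (x : X) : g x ≤ {x | ENNReal.ofReal t < 2 * g x}.indicator g x
        + ENNReal.ofReal t / 2 := by
      by_cases hx : ENNReal.ofReal t < 2 * g x
      · simp [indicator, hx]
      · simp only [indicator, mem_ofPred_eq, hx, if_false, zero_add]
        rw [ENNReal.le_div_iff_mul_le (by simp) (by simp), mul_comm]
        exact not_lt.1 hx
    have hsub : {x | ENNReal.ofReal t < ballMaximal d ν g x} ⊆ {x | ENNReal.ofReal t / 2 <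
        ballMaximal d ν ({x | ENNReal.ofReal t < 2 * g x}.indicator g) x} := by
      intro x hx
      by_contra hcon
      refine absurd (lt_of_lt_of_le hx (ballMaximal_le_add_const hle x)) (not_lt.2 ?_)
      calc _ ≤ ENNReal.ofReal t / 2 + ENNReal.ofReal t / 2 := by
            gcongr; exact not_lt.1 hcon
        _ = _ := ENNReal.add_halves _
    have h2 : ENNReal.ofReal t = 2 * (ENNReal.ofReal t / 2) :=
      (ENNReal.mul_div_cancel (by simp) (by simp)).symm
    calc ENNReal.ofReal t * ν {x | ENNReal.ofReal t < ballMaximal d ν g x}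
        ≤ 2 * (ENNReal.ofReal t / 2) * ν {x | ENNReal.ofReal t / 2 <
            ballMaximal d ν ({x | ENNReal.ofReal t < 2 * g x}.indicator g) x} := by
          rw [← h2]; gcongr
      _ ≤ 2 * (C * ∫⁻ x, {x | ENNReal.ofReal t < 2 * g x}.indicator g x ∂ν) := by
          rw [mul_assoc]; gcongr 2 * ?_; exact hC _ _
      _ = _ := by rw [lintegral_indicator hS, mul_assoc]
  have e1 := lintegral_mul_rpow_eq (ν := ν) hM (measurable_const (a := (1 : ℝ≥0∞)))
    (zero_lt_one.trans hs)
  have e2 := lintegral_mul_rpow_eq (ν := ν) (hg.const_mul 2) hg hs1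
  simp only [one_mul, setLIntegral_const] at e1
  have e3 : ∫⁻ x, g x * (2 * g x) ^ (s - 1) ∂ν = 2 ^ (s - 1) * ∫⁻ x, g x ^ s ∂ν := by
    rw [← lintegral_const_mul _ (hg.pow_const s)]
    refine lintegral_congr fun x => ?_
    rw [rpow_eq_mul_rpow_sub_one (g x) hs.le, ENNReal.mul_rpow_of_nonneg _ _ hs1.le]
    ring
  have hs0 : ENNReal.ofReal (s - 1) ≠ 0 := by simpa using hs
  calc ∫⁻ x, ballMaximal d ν g x ^ s ∂ν
      = ENNReal.ofReal s * ∫⁻ t in Ioi (0 : ℝ), ENNReal.ofReal t ^ (s - 1) *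
          ν {x | ENNReal.ofReal t < ballMaximal d ν g x} := e1
    _ ≤ ENNReal.ofReal s * ∫⁻ t in Ioi (0 : ℝ), (2 * C) * (ENNReal.ofReal t ^ (s - 1 - 1) *
          ∫⁻ x in {x | ENNReal.ofReal t < 2 * g x}, g x ∂ν) := by
        gcongr ENNReal.ofReal s * ?_
        refine setLIntegral_mono' measurableSet_Ioi fun t ht => ?_
        have ht0 : ENNReal.ofReal t ≠ 0 := by simpa using ht
        rw [ENNReal.rpow_sub (x := ENNReal.ofReal t) (s - 1) 1 ht0 ENNReal.ofReal_ne_top,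
          ENNReal.rpow_one]
        calc ENNReal.ofReal t ^ (s - 1) * ν {x | ENNReal.ofReal t < ballMaximal d ν g x}
            = ENNReal.ofReal t ^ (s - 1) / ENNReal.ofReal t *
              (ENNReal.ofReal t * ν {x | ENNReal.ofReal t < ballMaximal d ν g x}) := by
              rw [← mul_assoc, ENNReal.div_mul_cancel ht0 ENNReal.ofReal_ne_top]
          _ ≤ ENNReal.ofReal t ^ (s - 1) / ENNReal.ofReal t *
              (2 * C * ∫⁻ x in {x | ENNReal.ofReal t < 2 * g x}, g x ∂ν) := by
              gcongr ENNReal.ofReal t ^ (s - 1) / ENNReal.ofReal t * ?_; exact hlevel t ht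
          _ = _ := by ring
    _ = ENNReal.ofReal s * (2 * C) * ((ENNReal.ofReal (s - 1))⁻¹ *
          ∫⁻ x, g x * (2 * g x) ^ (s - 1) ∂ν) := by
        rw [lintegral_const_mul' _ _ (by finiteness), e2, ← mul_assoc (ENNReal.ofReal (s - 1))⁻¹,
          ENNReal.inv_mul_cancel hs0 ENNReal.ofReal_ne_top, one_mul, ← mul_assoc]
    _ = _ := by
        rw [e3]
        have hs2 : (s - 1).toNNReal ≠ 0 := by simpa using hs
        rw [ENNReal.ofReal, ENNReal.ofReal]
        push_cast [ENNReal.coe_inv hs2]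
        rw [ENNReal.coe_rpow_of_nonneg _ hs1.le]
        push_cast
        ring

end StrongType

/-! ### Muckenhoupt's theorem -/

section Muckenhoupt

variable {X : Type*} [MeasurableSpace X] {d : X → X → ℝ} {μ : Measure X} {q : ℝ} {w : X → ℝ≥0∞}

/-- The dual weight `w ^ (-1 / (q - 1))` of an `A_q` weight `w`. -/
noncomputable def dualWeight (q : ℝ) (w : X → ℝ≥0∞) (x : X) : ℝ≥0∞ :=
  w x ^ (-(1 / (q - 1)))

/-- `w` is an `A_q` weight with respect to the `d`-balls and the measure `μ`. The weight takes
values in `(0, ∞)` everywhere, and the `A_q` condition is written without averages. -/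
structure IsMuckenhouptWeight (d : X → X → ℝ) (μ : Measure X) (q : ℝ) (w : X → ℝ≥0∞) :
    Prop where
  measurable : Measurable w
  ne_zero : ∀ x, w x ≠ 0
  ne_top : ∀ x, w x ≠ ∞
  exists_bound : ∃ A : ℝ≥0, ∀ x r, 0 < r → (∫⁻ y in qball d x r, w y ∂μ) *
    (∫⁻ y in qball d x r, dualWeight q w y ∂μ) ^ (q - 1) ≤ A * μ (qball d x r) ^ q

namespace IsMuckenhouptWeight

lemma measurable_dualWeight (hw : IsMuckenhouptWeight d μ q w) : Measurable (dualWeight q w) :=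
  hw.measurable.pow_const _

lemma dualWeight_ne_zero (hw : IsMuckenhouptWeight d μ q w) (x : X) : dualWeight q w x ≠ 0 := by
  simp [dualWeight, ENNReal.rpow_eq_zero_iff, hw.ne_zero x, hw.ne_top x]

lemma dualWeight_ne_top (hw : IsMuckenhouptWeight d μ q w) (x : X) : dualWeight q w x ≠ ∞ := by
  simp [dualWeight, ENNReal.rpow_eq_top_iff, hw.ne_zero x, hw.ne_top x]

lemma setLIntegral_ne_zero {u : X → ℝ≥0∞} (hu : Measurable u) (hu0 : ∀ x, u x ≠ 0) {s : Set X}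
    (hs : μ s ≠ 0) : ∫⁻ y in s, u y ∂μ ≠ 0 := by
  rw [← pos_iff_ne_zero, setLIntegral_pos_iff hu, Function.support_eq_univ hu0, univ_inter]
  exact pos_iff_ne_zero.2 hs

/-- Hölder's inequality for `1 = w ^ (1 / q) * w ^ (-1 / q)`. -/
lemma measure_rpow_le (hw : IsMuckenhouptWeight d μ q w) (hq : 1 < q) (s : Set X) :
    μ s ^ q ≤ (∫⁻ y in s, w y ∂μ) * (∫⁻ y in s, dualWeight q w y ∂μ) ^ (q - 1) := by
  have hq0 : q ≠ 0 := by linarith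
  have hq1 : q - 1 ≠ 0 := by linarith
  have hH := ENNReal.lintegral_mul_le_Lp_mul_Lq (μ.restrict s)
    (Real.HolderConjugate.conjExponent hq) (f := fun x => w x ^ (1 / q))
    (g := fun x => w x ^ (-(1 / q))) (hw.measurable.pow_const _).aemeasurable
    (hw.measurable.pow_const _).aemeasurable
  have e1 (x : X) : ((fun x => w x ^ (1 / q)) * fun x => w x ^ (-(1 / q))) x = 1 := by
    simp only [Pi.mul_apply]
    rw [← ENNReal.rpow_add _ _ (hw.ne_zero x) (hw.ne_top x), add_neg_cancel, ENNReal.rpow_zero]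
  have e2 (x : X) : (w x ^ (1 / q)) ^ q = w x := by
    rw [← ENNReal.rpow_mul, one_div_mul_cancel hq0, ENNReal.rpow_one]
  have e3 (x : X) : (w x ^ (-(1 / q))) ^ q.conjExponent = dualWeight q w x := by
    rw [← ENNReal.rpow_mul, dualWeight, Real.conjExponent]
    congr 1
    field_simp
  simp only [e1, e2, e3, lintegral_const, Measure.restrict_apply_univ, one_mul] at hH
  calc μ s ^ q ≤ _ := ENNReal.rpow_le_rpow hH (by linarith)
    _ = _ := by
      rw [ENNReal.mul_rpow_of_nonneg _ _ (by linarith), ← ENNReal.rpow_mul, ← ENNReal.rpow_mul,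
        one_div_mul_cancel hq0, ENNReal.rpow_one, Real.conjExponent]
      congr 2
      field_simp

lemma setLIntegral_lt_top (hw : IsMuckenhouptWeight d μ q w) (h : IsDoublingSpace d μ)
    (hq : 1 < q) (x : X) {r : ℝ} (hr : 0 < r) :
    ∫⁻ y in qball d x r, w y ∂μ < ∞ ∧ ∫⁻ y in qball d x r, dualWeight q w y ∂μ < ∞ := by
  obtain ⟨A, hA⟩ := hw.exists_bound
  have h0 := (h.measure_ball_pos x r hr).ne'
  have hW := setLIntegral_ne_zero hw.measurable hw.ne_zero h0
  have hS := setLIntegral_ne_zero hw.measurable_dualWeight hw.dualWeight_ne_zero h0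
  have hlt : (∫⁻ y in qball d x r, w y ∂μ) *
      (∫⁻ y in qball d x r, dualWeight q w y ∂μ) ^ (q - 1) < ∞ :=
    (hA x r hr).trans_lt (ENNReal.mul_lt_top ENNReal.coe_lt_top
      (ENNReal.rpow_lt_top_of_nonneg (by linarith) (h.measure_ball_lt_top x r hr).ne))
  have hq1 : 0 < q - 1 := by linarith
  constructor
  · refine lt_top_iff_ne_top.2 fun htop => hlt.ne ?_
    rw [htop, ENNReal.top_mul]
    simp [ENNReal.rpow_eq_zero_iff, hS, hq.le]
  · refine lt_top_iff_ne_top.2 fun htop => hlt.ne ?_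
    rw [htop, ENNReal.top_rpow_of_pos hq1, ENNReal.mul_top hW]

lemma exists_doubling (hw : IsMuckenhouptWeight d μ q w) (h : IsDoublingSpace d μ) (hq : 1 < q) :
    ∃ D : ℝ≥0, ∀ x r, 0 < r → (∫⁻ y in qball d x (2 * r), w y ∂μ) *
        (∫⁻ y in qball d x (2 * r), dualWeight q w y ∂μ) ^ (q - 1) ≤
      D * ((∫⁻ y in qball d x r, w y ∂μ) *
        (∫⁻ y in qball d x r, dualWeight q w y ∂μ) ^ (q - 1)) := by
  obtain ⟨A, hA⟩ := hw.exists_bound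
  obtain ⟨C, hC⟩ := h.doubling
  refine ⟨A * C ^ q, fun x r hr => (hA x (2 * r) (by linarith)).trans ?_⟩
  have hq0 : 0 ≤ q := by linarith
  calc (A : ℝ≥0∞) * μ (qball d x (2 * r)) ^ q ≤ A * (C * μ (qball d x r)) ^ q := by
        gcongr; exact hC x r hr
    _ = ↑(A * C ^ q) * μ (qball d x r) ^ q := by
        rw [ENNReal.mul_rpow_of_nonneg _ _ hq0, ENNReal.coe_mul, ENNReal.coe_rpow_of_nonneg _ hq0,
          mul_assoc]
    _ ≤ _ := by gcongr; exact hw.measure_rpow_le hq _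

lemma isDoublingSpace_withDensity (hw : IsMuckenhouptWeight d μ q w) (h : IsDoublingSpace d μ)
    (hq : 1 < q) : IsDoublingSpace d (μ.withDensity w) where
  quasimetric := h.quasimetric
  measurable_dist := h.measurable_dist
  measure_ball_pos x r hr := by
    rw [withDensity_apply _ (h.measurableSet_qball x r), pos_iff_ne_zero]
    exact setLIntegral_ne_zero hw.measurable hw.ne_zero (h.measure_ball_pos x r hr).ne'
  measure_ball_lt_top x r hr := by
    rw [withDensity_apply _ (h.measurableSet_qball x r)]
    exact (hw.setLIntegral_lt_top h hq x hr).1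
  doubling := by
    obtain ⟨D, hD⟩ := hw.exists_doubling h hq
    refine ⟨D, fun x r hr => ?_⟩
    have hr2 : 0 < 2 * r := by linarith
    have hq1 : 0 < q - 1 := by linarith
    rw [withDensity_apply _ (h.measurableSet_qball x _),
      withDensity_apply _ (h.measurableSet_qball x _)]
    have hS0 := setLIntegral_ne_zero hw.measurable_dualWeight hw.dualWeight_ne_zero
      (h.measure_ball_pos x _ hr2).ne'
    have hSt := (hw.setLIntegral_lt_top h hq x hr2).2.ne
    refine (ENNReal.mul_le_mul_iff_left (c := (∫⁻ y in qball d x (2 * r),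
      dualWeight q w y ∂μ) ^ (q - 1)) ?_ ?_).1 ((hD x r hr).trans ?_)
    · simp [ENNReal.rpow_eq_zero_iff, hS0, hSt]
    · exact ENNReal.rpow_ne_top_of_nonneg hq1.le hSt
    · rw [mul_assoc]
      gcongr
      exact qball_mono d x (by linarith)

lemma isDoublingSpace_withDensity_dualWeight (hw : IsMuckenhouptWeight d μ q w)
    (h : IsDoublingSpace d μ) (hq : 1 < q) :
    IsDoublingSpace d (μ.withDensity (dualWeight q w)) where
  quasimetric := h.quasimetric
  measurable_dist := h.measurable_dist
  measure_ball_pos x r hr := by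
    rw [withDensity_apply _ (h.measurableSet_qball x r), pos_iff_ne_zero]
    exact setLIntegral_ne_zero hw.measurable_dualWeight hw.dualWeight_ne_zero
      (h.measure_ball_pos x r hr).ne'
  measure_ball_lt_top x r hr := by
    rw [withDensity_apply _ (h.measurableSet_qball x r)]
    exact (hw.setLIntegral_lt_top h hq x hr).2
  doubling := by
    obtain ⟨D, hD⟩ := hw.exists_doubling h hq
    refine ⟨D ^ (q - 1)⁻¹, fun x r hr => ?_⟩
    have hr2 : 0 < 2 * r := by linarith
    have hq1 : 0 < q - 1 := by linarith
    rw [withDensity_apply _ (h.measurableSet_qball x _),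
      withDensity_apply _ (h.measurableSet_qball x _)]
    have hW0 := setLIntegral_ne_zero hw.measurable hw.ne_zero (h.measure_ball_pos x _ hr2).ne'
    have hWt := (hw.setLIntegral_lt_top h hq x hr2).1.ne
    rw [← ENNReal.rpow_le_rpow_iff hq1, ENNReal.mul_rpow_of_nonneg _ _ hq1.le,
      ← ENNReal.coe_rpow_of_nonneg _ hq1.le, NNReal.rpow_inv_rpow hq1.ne']
    refine (ENNReal.mul_le_mul_iff_right hW0 hWt).1 ((hD x r hr).trans ?_)
    rw [mul_left_comm]
    gcongr
    exact qball_mono d x (by linarith)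

/-- Lerner's pointwise bound of the maximal operator by an iteration of the maximal operators of
the measures `σ μ` and `w μ`, where `σ` is the dual weight. -/
lemma exists_ballMaximal_rpow_le (hw : IsMuckenhouptWeight d μ q w) (h : IsDoublingSpace d μ)
    (hb : IsBoundedSpace d) (hq : 1 < q) :
    ∃ C : ℝ≥0, ∀ g : X → ℝ≥0∞, Measurable g → ∀ x, ballMaximal d μ g x ^ (q - 1) ≤
      C * ballMaximal d (μ.withDensity w) (fun y => ballMaximal d (μ.withDensity (dualWeight q w))
        (fun z => g z * (dualWeight q w z)⁻¹) y ^ (q - 1) * (w y)⁻¹) x := by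
  have hσ := hw.isDoublingSpace_withDensity_dualWeight h hq
  have := h.isFiniteMeasure hb
  have := hσ.isFiniteMeasure hb
  obtain ⟨A, hA⟩ := hw.exists_bound
  obtain ⟨K, hK1, hK⟩ := h.quasimetric.exists_one_le
  obtain ⟨C, hC⟩ := h.exists_dilation (K * (1 + 2 * K))
  have hq0 : 0 ≤ q := by linarith
  have hq1 : 0 < q - 1 := by linarith
  refine ⟨A * C ^ q, fun g hg x => ?_⟩
  set σ := dualWeight q w
  set H := ballMaximal d (μ.withDensity σ) (fun z => g z * (σ z)⁻¹)
  set G := ballMaximal d (μ.withDensity w) (fun y => H y ^ (q - 1) * (w y)⁻¹) x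
  have hgσ : Measurable fun z => g z * (σ z)⁻¹ := hg.mul hw.measurable_dualWeight.inv
  have hHm : Measurable H := measurable_ballMaximal h.measurable_dist hgσ
  rw [← ENNReal.le_rpow_inv_iff hq1]
  refine iSup₂_le fun r hr => ?_
  rw [ENNReal.le_rpow_inv_iff hq1]
  have hBm := h.measurableSet_qball x r
  have hB0 := (h.measure_ball_pos x r hr).ne'
  have hBt := (h.measure_ball_lt_top x r hr).ne
  have hrκ : r ≤ K * (1 + 2 * K) * r := le_mul_of_one_le_left hr.le (by nlinarith)
  -- For `y ∈ B(x, r)`, the inclusions `B(x, r) ⊆ B(y, 2Kr) ⊆ B(x, K(1 + 2K)r)` compare `∫ g`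
  -- with the average of `g / σ` over the ball centered at `y`.
  have hF (y : X) (hy : y ∈ qball d x r) : ∫⁻ z in qball d x r, g z ∂μ ≤
      (∫⁻ z in qball d x (K * (1 + 2 * K) * r), σ z ∂μ) * H y := by
    have hxy : d x y < r := hy
    have hr' : 0 < 2 * K * r := by positivity
    have s1 : qball d x r ⊆ qball d y (2 * K * r) := by
      intro z hz
      have hxz : d x z < r := hz
      have h1 := hK y z x
      rw [h.quasimetric.symm y x] at h1
      change d y z < _
      nlinarith
    have s2 : qball d y (2 * K * r) ⊆ qball d x (K * (1 + 2 * K) * r) := by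
      intro z hz
      have hyz : d y z < 2 * K * r := hz
      have h1 := hK x z y
      change d x z < _
      nlinarith
    have hym := h.measurableSet_qball y (2 * K * r)
    have p0 := (hσ.measure_ball_pos y _ hr').ne'
    have pt := (hσ.measure_ball_lt_top y _ hr').ne
    calc ∫⁻ z in qball d x r, g z ∂μ ≤ ∫⁻ z in qball d y (2 * K * r), g z ∂μ :=
          lintegral_mono_set s1
      _ = ∫⁻ z in qball d y (2 * K * r), g z * (σ z)⁻¹ ∂(μ.withDensity σ) := by
          rw [setLIntegral_withDensity_eq_setLIntegral_mul μ hw.measurable_dualWeight hgσ hym]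
          refine lintegral_congr fun z => ?_
          rw [Pi.mul_apply, mul_left_comm,
            ENNReal.mul_inv_cancel (hw.dualWeight_ne_zero z) (hw.dualWeight_ne_top z), mul_one]
      _ = (μ.withDensity σ) (qball d y (2 * K * r)) *
            (((μ.withDensity σ) (qball d y (2 * K * r)))⁻¹ *
              ∫⁻ z in qball d y (2 * K * r), g z * (σ z)⁻¹ ∂(μ.withDensity σ)) := by
          rw [← mul_assoc, ENNReal.mul_inv_cancel p0 pt, one_mul]
      _ ≤ (μ.withDensity σ) (qball d x (K * (1 + 2 * K) * r)) * H y := by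
          gcongr
          exact average_le_ballMaximal _ y hr'
      _ = _ := by rw [withDensity_apply _ (h.measurableSet_qball x _)]
  have hI : ∫⁻ y in qball d x r, H y ^ (q - 1) ∂μ ≤ (∫⁻ y in qball d x r, w y ∂μ) * G := by
    have hW := hw.isDoublingSpace_withDensity h hq
    have p0 := (hW.measure_ball_pos x r hr).ne'
    have pt := (hW.measure_ball_lt_top x r hr).ne
    calc ∫⁻ y in qball d x r, H y ^ (q - 1) ∂μ
        = ∫⁻ y in qball d x r, H y ^ (q - 1) * (w y)⁻¹ ∂(μ.withDensity w) := by
          have hHw : Measurable fun y => H y ^ (q - 1) * (w y)⁻¹ :=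
            (hHm.pow_const _).mul hw.measurable.inv
          rw [setLIntegral_withDensity_eq_setLIntegral_mul μ hw.measurable hHw hBm]
          refine lintegral_congr fun z => ?_
          rw [Pi.mul_apply, mul_left_comm,
            ENNReal.mul_inv_cancel (hw.ne_zero z) (hw.ne_top z), mul_one]
      _ = (μ.withDensity w) (qball d x r) * (((μ.withDensity w) (qball d x r))⁻¹ *
            ∫⁻ y in qball d x r, H y ^ (q - 1) * (w y)⁻¹ ∂(μ.withDensity w)) := by
          rw [← mul_assoc, ENNReal.mul_inv_cancel p0 pt, one_mul]
      _ ≤ (μ.withDensity w) (qball d x r) * G := by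
          gcongr
          exact average_le_ballMaximal _ x hr
      _ = _ := by rw [withDensity_apply _ hBm]
  set B := qball d x r
  set B' := qball d x (K * (1 + 2 * K) * r)
  have hmain : μ B * (∫⁻ z in B, g z ∂μ) ^ (q - 1) ≤ A * C ^ q * μ B ^ q * G := by
    calc μ B * (∫⁻ z in B, g z ∂μ) ^ (q - 1)
        = ∫⁻ _ in B, (∫⁻ z in B, g z ∂μ) ^ (q - 1) ∂μ := by rw [setLIntegral_const, mul_comm]
      _ ≤ ∫⁻ y in B, (∫⁻ z in B', σ z ∂μ) ^ (q - 1) * H y ^ (q - 1) ∂μ := by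
          refine setLIntegral_mono' hBm fun y hy => ?_
          rw [← ENNReal.mul_rpow_of_nonneg _ _ hq1.le]
          exact ENNReal.rpow_le_rpow (hF y hy) hq1.le
      _ = (∫⁻ z in B', σ z ∂μ) ^ (q - 1) * ∫⁻ y in B, H y ^ (q - 1) ∂μ :=
          lintegral_const_mul _ (hHm.pow_const _)
      _ ≤ (∫⁻ z in B', σ z ∂μ) ^ (q - 1) * ((∫⁻ y in B', w y ∂μ) * G) := by
          gcongr
          refine hI.trans ?_
          gcongr
          exact qball_mono d x hrκ
      _ = (∫⁻ y in B', w y ∂μ) * (∫⁻ z in B', σ z ∂μ) ^ (q - 1) * G := by ring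
      _ ≤ A * (C * μ B) ^ q * G := by
          gcongr ?_ * G
          refine (hA x _ (by positivity)).trans ?_
          gcongr
          exact hC x r hr
      _ = _ := by rw [ENNReal.mul_rpow_of_nonneg _ _ hq0]; ring
  have hBq0 : μ B ^ q ≠ 0 := by simp [ENNReal.rpow_eq_zero_iff, hB0, hBt]
  have hBqt : μ B ^ q ≠ ∞ := ENNReal.rpow_ne_top_of_nonneg hq0 hBt
  refine (ENNReal.mul_le_mul_iff_right hBq0 hBqt).1 ?_
  calc μ B ^ q * ((μ B)⁻¹ * ∫⁻ y in B, g y ∂μ) ^ (q - 1)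
      = μ B * (μ B * ((μ B)⁻¹ * ∫⁻ y in B, g y ∂μ)) ^ (q - 1) := by
        rw [rpow_eq_mul_rpow_sub_one _ hq.le, ENNReal.mul_rpow_of_nonneg (μ B) _ hq1.le, mul_assoc]
    _ = μ B * (∫⁻ y in B, g y ∂μ) ^ (q - 1) := by
        rw [← mul_assoc (μ B), ENNReal.mul_inv_cancel hB0 hBt, one_mul]
    _ ≤ _ := hmain
    _ = _ := by rw [ENNReal.coe_mul, ENNReal.coe_rpow_of_nonneg _ hq0]; ring

/-- Muckenhoupt's theorem: the maximal operator is bounded on `L^q(w)` for `A_q` weights `w`. -/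
theorem exists_lintegral_ballMaximal_le (hw : IsMuckenhouptWeight d μ q w)
    (h : IsDoublingSpace d μ) (hb : IsBoundedSpace d) (hq : 1 < q) :
    ∃ C : ℝ≥0, ∀ g : X → ℝ≥0∞, Measurable g →
      ∫⁻ x, ballMaximal d μ g x ^ q * w x ∂μ ≤ C * ∫⁻ x, g x ^ q * w x ∂μ := by
  have hσ := hw.isDoublingSpace_withDensity_dualWeight h hq
  have hW := hw.isDoublingSpace_withDensity h hq
  have := h.isFiniteMeasure hb
  have := hσ.isFiniteMeasure hb
  have := hW.isFiniteMeasure hb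
  have hq0 : 0 < q := by linarith
  have hq1 : 0 < q - 1 := by linarith
  have hq' : 1 < q / (q - 1) := by rw [lt_div_iff₀ hq1]; linarith
  have hq'0 : 0 ≤ q / (q - 1) := by linarith
  obtain ⟨C, hC⟩ := hw.exists_ballMaximal_rpow_le h hb hq
  obtain ⟨C₁, hC₁⟩ := hσ.strong_type hb hq
  obtain ⟨C₂, hC₂⟩ := hW.strong_type hb hq'
  refine ⟨C ^ (q / (q - 1)) * (C₂ * C₁), fun g hg => ?_⟩
  specialize hC g hg
  set σ := dualWeight q w
  have hgσ : Measurable fun z => g z * (σ z)⁻¹ := hg.mul hw.measurable_dualWeight.inv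
  set H := ballMaximal d (μ.withDensity σ) (fun z => g z * (σ z)⁻¹)
  have hHm : Measurable H := measurable_ballMaximal h.measurable_dist hgσ
  have hHw : Measurable fun y => H y ^ (q - 1) * (w y)⁻¹ :=
    (hHm.pow_const _).mul hw.measurable.inv
  set G := ballMaximal d (μ.withDensity w) (fun y => H y ^ (q - 1) * (w y)⁻¹)
  have hGm : Measurable G := measurable_ballMaximal h.measurable_dist hHw
  have hpt (x : X) : ballMaximal d μ g x ^ q ≤ C ^ (q / (q - 1)) * G x ^ (q / (q - 1)) := by
    calc ballMaximal d μ g x ^ q = (ballMaximal d μ g x ^ (q - 1)) ^ (q / (q - 1)) := by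
          rw [← ENNReal.rpow_mul, mul_div_cancel₀ _ hq1.ne']
      _ ≤ (C * G x) ^ (q / (q - 1)) := ENNReal.rpow_le_rpow (hC x) hq'0
      _ = _ := ENNReal.mul_rpow_of_nonneg _ _ hq'0
  have e1 (x : X) : w x * (H x ^ (q - 1) * (w x)⁻¹) ^ (q / (q - 1)) = σ x * H x ^ q := by
    rw [ENNReal.mul_rpow_of_nonneg _ _ hq'0, ← ENNReal.rpow_mul, mul_div_cancel₀ _ hq1.ne',
      ← ENNReal.rpow_neg_one, ← ENNReal.rpow_mul, mul_left_comm, mul_comm (H x ^ q)]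
    congr 1
    nth_rewrite 1 [← ENNReal.rpow_one (w x)]
    rw [← ENNReal.rpow_add _ _ (hw.ne_zero x) (hw.ne_top x)]
    change _ = w x ^ (-(1 / (q - 1)))
    congr 1
    field_simp
    ring
  have e2 (x : X) : σ x * (g x * (σ x)⁻¹) ^ q = g x ^ q * w x := by
    rw [ENNReal.mul_rpow_of_nonneg _ _ hq0.le, mul_left_comm]
    congr 1
    change w x ^ (-(1 / (q - 1))) * ((w x ^ (-(1 / (q - 1))))⁻¹) ^ q = w x
    rw [← ENNReal.rpow_neg, ← ENNReal.rpow_mul,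
      ← ENNReal.rpow_add _ _ (hw.ne_zero x) (hw.ne_top x)]
    have : -(1 / (q - 1)) + - -(1 / (q - 1)) * q = 1 := by field_simp; ring
    rw [this, ENNReal.rpow_one]
  calc ∫⁻ x, ballMaximal d μ g x ^ q * w x ∂μ
      ≤ ∫⁻ x, C ^ (q / (q - 1)) * (w x * G x ^ (q / (q - 1))) ∂μ := by
        refine lintegral_mono fun x => ?_
        calc _ ≤ C ^ (q / (q - 1)) * G x ^ (q / (q - 1)) * w x := by gcongr; exact hpt x
          _ = _ := by ring
    _ = C ^ (q / (q - 1)) * ∫⁻ x, G x ^ (q / (q - 1)) ∂(μ.withDensity w) := by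
        have hwG : Measurable fun x => w x * G x ^ (q / (q - 1)) :=
          hw.measurable.mul (hGm.pow_const _)
        rw [lintegral_const_mul _ hwG,
          lintegral_withDensity_eq_lintegral_mul μ hw.measurable (hGm.pow_const _)]
        rfl
    _ ≤ C ^ (q / (q - 1)) * (C₂ * ∫⁻ x, (H x ^ (q - 1) * (w x)⁻¹) ^ (q / (q - 1))
          ∂(μ.withDensity w)) := by
        gcongr; exact hC₂ _ hHw
    _ = C ^ (q / (q - 1)) * (C₂ * ∫⁻ x, H x ^ q ∂(μ.withDensity σ)) := by
        rw [lintegral_withDensity_eq_lintegral_mul μ hw.measurable (hHw.pow_const _),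
          lintegral_withDensity_eq_lintegral_mul μ hw.measurable_dualWeight (hHm.pow_const _)]
        simp only [Pi.mul_apply, e1]
        rfl
    _ ≤ C ^ (q / (q - 1)) * (C₂ * (C₁ * ∫⁻ x, (g x * (σ x)⁻¹) ^ q ∂(μ.withDensity σ))) := by
        gcongr; exact hC₁ _ hgσ
    _ = C ^ (q / (q - 1)) * (C₂ * (C₁ * ∫⁻ x, g x ^ q * w x ∂μ)) := by
        rw [lintegral_withDensity_eq_lintegral_mul μ hw.measurable_dualWeight (hgσ.pow_const _)]
        congr 3
        exact lintegral_congr e2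
    _ = _ := by
        push_cast
        rw [ENNReal.coe_rpow_of_nonneg _ hq'0]
        ring

end IsMuckenhouptWeight

end Muckenhoupt

/-! ### The pointwise estimate for variable exponents -/

section Pointwise

variable {X : Type*} [MeasurableSpace X] {d : X → X → ℝ} {μ : Measure X}

/-- The lower mass bound `D / μ B(x, r) ≤ r ^ (-L)` in a bounded doubling space. The constant `D`
is absorbed in the exponent, which is possible because `r ≤ 1 / 2`. -/
lemma IsDoublingSpace.exists_mul_inv_measure_le (h : IsDoublingSpace d μ) (hb : IsBoundedSpace d)
    {D : ℝ≥0∞} (hD : D ≠ ∞) : ∃ L : ℝ, 0 ≤ L ∧ ∀ x r, 0 < r → r ≤ 1 / 2 →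
      D * (μ (qball d x r))⁻¹ ≤ ENNReal.ofReal (Real.exp (L * Real.log (1 / r))) := by
  rcases isEmpty_or_nonempty X with hX | ⟨⟨x₀⟩⟩
  · exact ⟨0, le_rfl, fun x => isEmptyElim x⟩
  obtain ⟨C', hC'⟩ := h.doubling
  obtain ⟨C, hC1, hC⟩ : ∃ C : ℝ≥0, 1 ≤ C ∧
      ∀ x r, 0 < r → μ (qball d x (2 * r)) ≤ C * μ (qball d x r) := by
    refine ⟨max C' 1, le_max_right _ _, fun x r hr => (hC' x r hr).trans ?_⟩
    gcongr
    exact le_max_left _ _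
  have hU0 : μ univ ≠ 0 :=
    ((h.measure_ball_pos x₀ 1 one_pos).trans_le (measure_mono (subset_univ _))).ne'
  obtain ⟨M, hM⟩ : ∃ M : ℝ≥0, D * (μ univ)⁻¹ = M :=
    ⟨_, (ENNReal.coe_toNNReal (ENNReal.mul_ne_top hD (ENNReal.inv_ne_top.2 hU0))).symm⟩
  obtain ⟨R', hR'⟩ := hb
  obtain ⟨R, hR1, hR⟩ : ∃ R : ℝ, 1 ≤ R ∧ ∀ x y, d x y < R :=
    ⟨max R' 0 + 1, by linarith [le_max_right R' 0],
      fun x y => (hR' x y).trans_lt (by linarith [le_max_left R' 0])⟩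
  have hl2 : 0 < Real.log 2 := Real.log_pos one_lt_two
  have hlC : 0 ≤ Real.log C := Real.log_nonneg (by exact_mod_cast hC1)
  have hR0 : 0 < R := by linarith
  have hlR : 0 ≤ Real.log R := Real.log_nonneg hR1
  refine ⟨(M + Real.log C * (Real.log R / Real.log 2 + 1)) / Real.log 2
    + Real.log C / Real.log 2, by positivity, fun x r hr hr2 => ?_⟩
  have hlr : Real.log 2 ≤ Real.log (1 / r) := by
    refine Real.log_le_log two_pos ?_
    rw [le_div_iff₀ hr]; linarith
  obtain ⟨n, hn1, hn2⟩ : ∃ n : ℕ, R ≤ 2 ^ n * r ∧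
      (n : ℝ) ≤ (Real.log R + Real.log (1 / r)) / Real.log 2 + 1 := by
    refine ⟨⌈(Real.log R + Real.log (1 / r)) / Real.log 2⌉₊, ?_,
      (Nat.ceil_lt_add_one
        (div_nonneg (add_nonneg hlR (hl2.le.trans hlr)) hl2.le)).le⟩
    have h1 := Nat.le_ceil ((Real.log R + Real.log (1 / r)) / Real.log 2)
    set n := ⌈(Real.log R + Real.log (1 / r)) / Real.log 2⌉₊
    rw [div_le_iff₀ hl2, ← Real.log_mul hR0.ne' (by positivity), ← Real.log_pow,
      Real.log_le_log_iff (by positivity) (by positivity), mul_one_div, div_le_iff₀ hr] at h1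
    exact h1
  have hball : μ univ ≤ (C : ℝ≥0∞) ^ n * μ (qball d x r) := by
    refine le_trans (measure_mono fun y _ => ?_) (measure_qball_two_pow_le hC n x r hr)
    exact (hR x y).trans_le hn1
  have hC0 : (C : ℝ≥0∞) ^ n ≠ 0 := pow_ne_zero _ (by simpa using (zero_lt_one.trans_le hC1).ne')
  have hCt : (C : ℝ≥0∞) ^ n ≠ ∞ := by finiteness
  have hinv : (μ (qball d x r))⁻¹ ≤ (C : ℝ≥0∞) ^ n * (μ univ)⁻¹ := by
    have := ENNReal.inv_le_inv.2 hball
    rw [ENNReal.mul_inv (Or.inl hC0) (Or.inl hCt)] at this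
    calc (μ (qball d x r))⁻¹
        = (C : ℝ≥0∞) ^ n * (((C : ℝ≥0∞) ^ n)⁻¹ * (μ (qball d x r))⁻¹) := by
          rw [← mul_assoc, ENNReal.mul_inv_cancel hC0 hCt, one_mul]
      _ ≤ _ := by gcongr
  calc D * (μ (qball d x r))⁻¹ ≤ D * ((C : ℝ≥0∞) ^ n * (μ univ)⁻¹) := by gcongr
    _ = ENNReal.ofReal (M * (C : ℝ) ^ n) := by
        rw [mul_left_comm, hM, ENNReal.ofReal_mul M.coe_nonneg, ENNReal.ofReal_pow C.coe_nonneg,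
          ENNReal.ofReal_coe_nnreal, ENNReal.ofReal_coe_nnreal, mul_comm]
    _ ≤ ENNReal.ofReal (Real.exp M * Real.exp (n * Real.log C)) := by
        have hCe : (C : ℝ) ^ n = Real.exp (n * Real.log C) := by
          rw [Real.exp_nat_mul, Real.exp_log (by exact_mod_cast zero_lt_one.trans_le hC1)]
        rw [hCe]
        gcongr
        linarith [Real.add_one_le_exp (M : ℝ)]
    _ ≤ _ := by
        rw [← Real.exp_add]
        gcongr
        have hlr0 : 0 ≤ Real.log (1 / r) := hl2.le.trans hlr
        have hM0 : 0 ≤ (M : ℝ) := M.2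
        have k1 : n * Real.log C ≤
            ((Real.log R + Real.log (1 / r)) / Real.log 2 + 1) * Real.log C := by gcongr
        have k2 : M + Real.log C * (Real.log R / Real.log 2 + 1) ≤
            (M + Real.log C * (Real.log R / Real.log 2 + 1)) / Real.log 2 * Real.log (1 / r) := by
          rw [div_mul_eq_mul_div, le_div_iff₀ hl2]
          gcongr
        calc M + n * Real.log C
            ≤ M + ((Real.log R + Real.log (1 / r)) / Real.log 2 + 1) * Real.log C := by gcongr
          _ = (M + Real.log C * (Real.log R / Real.log 2 + 1))
              + Real.log C / Real.log 2 * Real.log (1 / r) := by ring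
          _ ≤ _ := by rw [add_mul]; gcongr

/-- Log-Hölder continuity in the form in which it is used: the oscillation `δ` of the exponent on
a ball is so small that `μ B ^ (-δ)` stays bounded. -/
lemma IsDoublingSpace.exists_oscillation_bound (h : IsDoublingSpace d μ) (hb : IsBoundedSpace d)
    {s : X → ℝ} {A S : ℝ} (hA : 0 ≤ A) (hs0 : ∀ x, 0 ≤ s x) (hsS : ∀ x, s x ≤ S) (hS : 0 ≤ S)
    (hs : ∀ x y, x ≠ y → d x y ≤ 1 / 2 → |s x - s y| ≤ A / Real.log (1 / d x y))
    {D : ℝ≥0∞} (hD : D ≠ ∞) :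
    ∃ C : ℝ≥0, ∀ x r, 0 < r → ∃ δ : ℝ, 0 ≤ δ ∧ (∀ y ∈ qball d x r, s x - δ ≤ s y) ∧
      ∀ b : ℝ≥0∞, b ≤ D * (μ (qball d x r))⁻¹ → b ^ δ ≤ C := by
  obtain ⟨L, hL, hmass⟩ := h.exists_mul_inv_measure_le hb hD
  refine ⟨(Real.exp (L * A)).toNNReal + (Real.exp (L * Real.log 2 * S)).toNNReal,
    fun x r hr => ?_⟩
  push_cast
  rcases le_or_gt r (1 / 2) with hr2 | hr2
  · have hlr : 0 < Real.log (1 / r) := by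
      refine Real.log_pos ?_
      rw [lt_div_iff₀ hr]; linarith
    refine ⟨A / Real.log (1 / r), by positivity, fun y hy => ?_, fun b hb => ?_⟩
    · rcases eq_or_ne x y with rfl | hxy
      · linarith [div_nonneg hA hlr.le]
      · have hdr : d x y < r := hy
        have hd0 : 0 < d x y := lt_of_le_of_ne (h.quasimetric.nonneg x y)
          fun e => hxy ((h.quasimetric.eq_zero_iff x y).1 e.symm)
        have h1 := hs x y hxy (by linarith)
        have h2 : A / Real.log (1 / d x y) ≤ A / Real.log (1 / r) := by gcongr
        linarith [le_abs_self (s x - s y)]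
    · refine le_trans ?_ le_self_add
      calc b ^ (A / Real.log (1 / r))
          ≤ ENNReal.ofReal (Real.exp (L * Real.log (1 / r))) ^ (A / Real.log (1 / r)) :=
            ENNReal.rpow_le_rpow (hb.trans (hmass x r hr hr2)) (by positivity)
        _ = _ := by
            rw [ENNReal.ofReal_rpow_of_pos (Real.exp_pos _), ← Real.exp_mul, ENNReal.ofReal]
            congr 3
            field_simp
  · -- Large balls have measure bounded below, so the trivial oscillation bound suffices.
    refine ⟨S, hS, fun y _ => by linarith [hs0 y, hsS x], fun b hb => ?_⟩
    refine le_trans ?_ le_add_self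
    have h1 : b ≤ ENNReal.ofReal (Real.exp (L * Real.log 2)) := by
      refine hb.trans (le_trans ?_ ((hmass x (1 / 2) (by norm_num) le_rfl).trans_eq (by norm_num)))
      gcongr
      exact qball_mono d x hr2.le
    calc b ^ S ≤ ENNReal.ofReal (Real.exp (L * Real.log 2)) ^ S := ENNReal.rpow_le_rpow h1 hS
      _ = _ := by rw [ENNReal.ofReal_rpow_of_pos (Real.exp_pos _), ← Real.exp_mul]; rfl

/-- Jensen's inequality for averages of functions with values in `[0, ∞]`. -/
lemma setAverage_rpow_le {B : Set X} (h0 : μ B ≠ 0) (ht : μ B ≠ ∞) {g : X → ℝ≥0∞}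
    (hg : Measurable g) {P : ℝ} (hP : 1 ≤ P) :
    ((μ B)⁻¹ * ∫⁻ y in B, g y ∂μ) ^ P ≤ (μ B)⁻¹ * ∫⁻ y in B, g y ^ P ∂μ := by
  have : IsProbabilityMeasure ((μ B)⁻¹ • μ.restrict B) :=
    ⟨by simp [ENNReal.inv_mul_cancel h0 ht]⟩
  have hJ := eLpNorm'_le_eLpNorm'_of_exponent_le zero_lt_one hP ((μ B)⁻¹ • μ.restrict B)
    hg.aestronglyMeasurable
  have hP0 : 0 < P := by linarith
  simp only [eLpNorm', enorm_eq_self, ENNReal.rpow_one, div_one, lintegral_smul_measure,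
    smul_eq_mul] at hJ
  rwa [one_div, ENNReal.le_rpow_inv_iff hP0] at hJ

lemma rpow_le_rpow_add_one (a : ℝ≥0∞) {P s : ℝ} (hP : 0 ≤ P) (h : P ≤ s) : a ^ P ≤ a ^ s + 1 := by
  rcases le_total a 1 with ha | ha
  · exact (ENNReal.rpow_le_one ha hP).trans le_add_self
  · exact (ENNReal.rpow_le_rpow_of_exponent_le ha h).trans le_self_add

/-- The pointwise estimate `(M g) ^ s ≲ M (g ^ s) + 1` for a log-Hölder exponent `s ≥ 1` and all
`g` with a given bound `S₀` of `∫ g ^ s`. -/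
lemma IsDoublingSpace.exists_ballMaximal_rpow_le (h : IsDoublingSpace d μ) (hb : IsBoundedSpace d)
    {s : X → ℝ} {A S : ℝ} (hA : 0 ≤ A) (hs1 : ∀ x, 1 ≤ s x)
    (hsS : ∀ x, s x ≤ S)
    (hs : ∀ x y, x ≠ y → d x y ≤ 1 / 2 → |s x - s y| ≤ A / Real.log (1 / d x y))
    {S₀ : ℝ≥0∞} (hS₀ : S₀ ≠ ∞) :
    ∃ C : ℝ≥0, ∀ g : X → ℝ≥0∞, Measurable g → ∫⁻ y, g y ^ s y ∂μ ≤ S₀ → ∀ x,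
      ballMaximal d μ g x ^ s x ≤ C * (ballMaximal d μ (fun y => g y ^ s y) x + 1) := by
  have hD : S₀ + μ univ ≠ ∞ := ENNReal.add_ne_top.2 ⟨hS₀, (h.measure_univ_lt_top hb).ne⟩
  obtain ⟨C, hC⟩ := h.exists_oscillation_bound hb hA (fun x => zero_le_one.trans (hs1 x))
    (fun x => (hsS x).trans (le_max_left S 0)) (le_max_right S 0) hs hD
  refine ⟨C, fun g hg hgS x => ?_⟩
  have hsx : 0 < s x := zero_lt_one.trans_le (hs1 x)
  rw [← ENNReal.le_rpow_inv_iff hsx]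
  refine iSup₂_le fun r hr => ?_
  rw [ENNReal.le_rpow_inv_iff hsx]
  obtain ⟨δ, hδ, hosc, hbd⟩ := hC x r hr
  have hBm := h.measurableSet_qball x r
  have h0 := (h.measure_ball_pos x r hr).ne'
  have ht := (h.measure_ball_lt_top x r hr).ne
  set B := qball d x r
  set a := (μ B)⁻¹ * ∫⁻ y in B, g y ∂μ
  set b := (μ B)⁻¹ * ∫⁻ y in B, (g y ^ s y + 1) ∂μ
  have hb' : b = (μ B)⁻¹ * (∫⁻ y in B, g y ^ s y ∂μ) + 1 := by
    simp only [b]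
    rw [lintegral_add_right _ measurable_const, setLIntegral_const, one_mul, mul_add,
      ENNReal.inv_mul_cancel h0 ht]
  have hb1 : 1 ≤ b := by rw [hb']; exact le_add_self
  have hbD : b ≤ (S₀ + μ univ) * (μ B)⁻¹ := by
    rw [mul_comm]
    simp only [b]
    gcongr
    rw [lintegral_add_right _ measurable_const, setLIntegral_const, one_mul]
    gcongr
    · exact (setLIntegral_le_lintegral _ _).trans hgS
    · exact subset_univ _
  -- A lower bound of the exponent on the ball that differs from `s x` by at most `δ`.
  set P := max 1 (s x - δ)
  have hP1 : 1 ≤ P := le_max_left _ _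
  have hP0 : 0 < P := by linarith
  have haP : a ^ P ≤ b := by
    refine (setAverage_rpow_le h0 ht hg hP1).trans ?_
    simp only [b]
    gcongr (μ B)⁻¹ * ?_
    refine setLIntegral_mono' hBm fun y hy => rpow_le_rpow_add_one _ hP0.le ?_
    exact max_le (hs1 y) (hosc y hy)
  have hsP : s x / P ≤ 1 + δ := by
    rw [div_le_iff₀ hP0]
    have : s x - δ ≤ P := le_max_right _ _
    nlinarith
  calc a ^ s x = (a ^ P) ^ (s x / P) := by
        rw [← ENNReal.rpow_mul, mul_div_cancel₀ _ hP0.ne']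
    _ ≤ b ^ (s x / P) := ENNReal.rpow_le_rpow haP (by positivity)
    _ ≤ b ^ (1 + δ) := ENNReal.rpow_le_rpow_of_exponent_le hb1 hsP
    _ = b ^ δ * b := by
        rw [ENNReal.rpow_add_of_nonneg _ _ zero_le_one hδ, ENNReal.rpow_one, mul_comm]
    _ ≤ C * (ballMaximal d μ (fun y => g y ^ s y) x + 1) := by
        gcongr
        · exact hbd b hbD
        · rw [hb']
          gcongr
          exact average_le_ballMaximal _ x hr

end Pointwise

/-! ### Variable exponent spaces -/

section VariableExponent

variable {X : Type*} [MeasurableSpace X] {d : X → X → ℝ} {μ : Measure X} {p ρ : X → ℝ}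

lemma IsExponent.pMinus_le (hp : IsExponent d p) (x : X) : pMinus p ≤ p x := by
  refine ciInf_le ?_ x
  -- An infimum over an unbounded range would be the junk value `0`, against `1 < p₋`.
  by_contra hcon
  have h1 := hp.one_lt_pMinus
  rw [pMinus, Real.iInf_of_not_bddBelow hcon] at h1
  linarith

lemma IsExponent.one_le (hp : IsExponent d p) (x : X) : 1 ≤ p x :=
  hp.one_lt_pMinus.le.trans (hp.pMinus_le x)

/-- The modular inequality: `∫ (M g) ^ p w` is bounded on the unit ball of the modular
`∫ g ^ p w`, when `w` is an `A_q` weight for `q = p₋`. -/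
theorem IsMuckenhouptWeight.exists_modular_bound {w : X → ℝ≥0∞}
    (hw : IsMuckenhouptWeight d μ (pMinus p) w) (h : IsDoublingSpace d μ) (hb : IsBoundedSpace d)
    (hp : IsExponent d p) :
    ∃ C : ℝ≥0, ∀ g : X → ℝ≥0∞, Measurable g → ∫⁻ x, g x ^ p x * w x ∂μ ≤ 1 →
      ∫⁻ x, ballMaximal d μ g x ^ p x * w x ∂μ ≤ C := by
  have hq := hp.one_lt_pMinus
  have hpq := hp.pMinus_le
  set q := pMinus p
  have hq0 : 0 < q := by linarith
  have hq1 : 0 < q - 1 := by linarith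
  have := h.isFiniteMeasure hb
  have hσt : ∫⁻ x, dualWeight q w x ∂μ ≠ ∞ := by
    have := (hw.isDoublingSpace_withDensity_dualWeight h hq).measure_univ_lt_top hb
    rw [withDensity_apply _ MeasurableSet.univ, setLIntegral_univ] at this
    exact this.ne
  have hwt : ∫⁻ x, w x ∂μ ≠ ∞ := by
    have := (hw.isDoublingSpace_withDensity h hq).measure_univ_lt_top hb
    rw [withDensity_apply _ MeasurableSet.univ, setLIntegral_univ] at this
    exact this.ne
  obtain ⟨A, hA⟩ := hp.logHolder
  obtain ⟨S, hS⟩ := hp.bddAbove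
  have hsm : Measurable fun x => p x / q := hp.measurable.div_const q
  obtain ⟨C, hC⟩ := h.exists_ballMaximal_rpow_le hb (s := fun x => p x / q) (A := |A| / q)
    (S := S / q) (by positivity)
    (fun x => (one_le_div hq0).2 (hpq x))
    (fun x => by have := hS (mem_range_self x); gcongr)
    (fun x y hxy hd => by
      have hd0 : 0 ≤ d x y := h.quasimetric.nonneg x y
      have hdp : 0 < d x y := lt_of_le_of_ne hd0
        fun e => hxy ((h.quasimetric.eq_zero_iff x y).1 e.symm)
      have hl : 0 ≤ Real.log (1 / d x y) := by
        refine Real.log_nonneg ?_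
        rw [le_div_iff₀ hdp]; linarith
      rw [← sub_div, abs_div, abs_of_pos hq0, div_right_comm]
      gcongr
      refine (hA x y hxy hd).trans ?_
      gcongr
      exact le_abs_self A)
    (S₀ := 1 + ∫⁻ x, dualWeight q w x ∂μ) (by finiteness)
  obtain ⟨C₁, hC₁⟩ := hw.exists_lintegral_ballMaximal_le h hb hq
  refine ⟨C ^ q * 2 ^ (q - 1) * (C₁ + (∫⁻ x, w x ∂μ).toNNReal), fun g hg hg1 => ?_⟩
  have hgm : Measurable fun y => g y ^ (p y / q) := hg.pow hsm
  have hpow (a : ℝ≥0∞) (x : X) : (a ^ (p x / q)) ^ q = a ^ p x := by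
    rw [← ENNReal.rpow_mul, div_mul_cancel₀ _ hq0.ne']
  have hint : ∫⁻ y, g y ^ (p y / q) ∂μ ≤ 1 + ∫⁻ x, dualWeight q w x ∂μ := by
    calc ∫⁻ y, g y ^ (p y / q) ∂μ ≤ ∫⁻ y, (g y ^ p y * w y + dualWeight q w y) ∂μ := by
          refine lintegral_mono fun y => ?_
          rw [← hpow]
          set u := g y ^ (p y / q)
          -- If `u` exceeds the dual weight, then `u ^ (q - 1) * w ≥ 1`.
          rcases le_total u (dualWeight q w y) with hu | hu
          · exact hu.trans le_add_self
          · refine le_trans ?_ le_self_add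
            have h1 : (w y)⁻¹ ≤ u ^ (q - 1) := by
              refine le_trans (le_of_eq ?_) (ENNReal.rpow_le_rpow hu hq1.le)
              rw [dualWeight, ← ENNReal.rpow_mul, neg_mul, one_div_mul_cancel hq1.ne',
                ENNReal.rpow_neg_one]
            calc u = u * (w y)⁻¹ * w y := by
                  rw [mul_assoc, ENNReal.inv_mul_cancel (hw.ne_zero y) (hw.ne_top y), mul_one]
              _ ≤ u * u ^ (q - 1) * w y := by gcongr
              _ = _ := by rw [rpow_eq_mul_rpow_sub_one u hq.le]
      _ = ∫⁻ y, g y ^ p y * w y ∂μ + ∫⁻ y, dualWeight q w y ∂μ :=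
          lintegral_add_right _ hw.measurable_dualWeight
      _ ≤ _ := by gcongr
  have hMm : Measurable (ballMaximal d μ fun y => g y ^ (p y / q)) :=
    measurable_ballMaximal h.measurable_dist hgm
  calc ∫⁻ x, ballMaximal d μ g x ^ p x * w x ∂μ
      ≤ ∫⁻ x, C ^ q * 2 ^ (q - 1) *
          (ballMaximal d μ (fun y => g y ^ (p y / q)) x ^ q * w x + w x) ∂μ := by
        refine lintegral_mono fun x => ?_
        calc ballMaximal d μ g x ^ p x * w x
            = (ballMaximal d μ g x ^ (p x / q)) ^ q * w x := by rw [hpow]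
          _ ≤ (C * (ballMaximal d μ (fun y => g y ^ (p y / q)) x + 1)) ^ q * w x := by
              gcongr; exact hC g hg hint x
          _ = C ^ q * (ballMaximal d μ (fun y => g y ^ (p y / q)) x + 1) ^ q * w x := by
              rw [ENNReal.mul_rpow_of_nonneg _ _ hq0.le]
          _ ≤ C ^ q * (2 ^ (q - 1) *
                (ballMaximal d μ (fun y => g y ^ (p y / q)) x ^ q + 1 ^ q)) * w x := by
              gcongr; exact ENNReal.rpow_add_le_mul_rpow_add_rpow _ _ hq.le
          _ = _ := by rw [ENNReal.one_rpow]; ring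
    _ = C ^ q * 2 ^ (q - 1) *
          (∫⁻ x, ballMaximal d μ (fun y => g y ^ (p y / q)) x ^ q * w x ∂μ + ∫⁻ x, w x ∂μ) := by
        have hMw : Measurable fun x =>
            ballMaximal d μ (fun y => g y ^ (p y / q)) x ^ q * w x + w x :=
          ((hMm.pow_const q).mul hw.measurable).add hw.measurable
        rw [lintegral_const_mul _ hMw, lintegral_add_right _ hw.measurable]
    _ ≤ C ^ q * 2 ^ (q - 1) * (C₁ * 1 + ∫⁻ x, w x ∂μ) := by
        gcongr
        refine (hC₁ _ hgm).trans ?_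
        gcongr
        simpa only [hpow] using hg1
    _ = _ := by
        push_cast
        rw [ENNReal.coe_toNNReal hwt, ENNReal.coe_rpow_of_nonneg _ hq0.le,
          ENNReal.coe_rpow_of_nonneg _ hq1.le, mul_one]
        rfl

/-- A weight of the class `Ã` gives the `A_q` weight `ρ ^ p`, `q = p₋`, after a modification on a
null set that makes it measurable, positive and finite everywhere. -/
lemma exists_isMuckenhouptWeight (h : IsDoublingSpace d μ) (hp : IsExponent d p)
    (hρ : IsWeight μ ρ) (hM : MuckenhouptLike d μ p ρ) :
    ∃ w : X → ℝ≥0∞, IsMuckenhouptWeight d μ (pMinus p) w ∧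
      ∀ᵐ x ∂μ, w x = ENNReal.ofReal (ρ x) ^ p x := by
  have hq := hp.one_lt_pMinus
  have hq1 : 0 < pMinus p - 1 := by linarith
  set ρ₀ := hρ.aemeasurable.mk ρ
  have hρ₀ : Measurable ρ₀ := hρ.aemeasurable.measurable_mk
  set w : X → ℝ≥0∞ := fun x => if 0 < ρ₀ x then ENNReal.ofReal (ρ₀ x) ^ p x else 1 with hwdef
  have hae : ∀ᵐ x ∂μ, w x = ENNReal.ofReal (ρ x) ^ p x := by
    filter_upwards [hρ.aemeasurable.ae_eq_mk, hρ.pos] with x hx hx0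
    have : ρ x = ρ₀ x := hx
    simp only [hwdef]
    rw [if_pos (this ▸ hx0), this]
  have hdual (B : Set X) : ∫⁻ y in B, dualWeight (pMinus p) w y ∂μ =
      ∫⁻ y in B, (ENNReal.ofReal (ρ y) ^ (p y / (pMinus p - 1)))⁻¹ ∂μ := by
    refine lintegral_congr_ae (ae_restrict_of_ae ?_)
    filter_upwards [hae] with x hx
    rw [dualWeight, hx, ← ENNReal.rpow_mul, ← ENNReal.rpow_neg]
    congr 1
    ring
  have hint (B : Set X) : ∫⁻ y in B, w y ∂μ = ∫⁻ y in B, ENNReal.ofReal (ρ y) ^ p y ∂μ :=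
    lintegral_congr_ae (ae_restrict_of_ae hae)
  refine ⟨w, ⟨?_, fun x => ?_, fun x => ?_, ?_⟩, hae⟩
  · exact Measurable.ite (measurableSet_lt measurable_const hρ₀)
      (hρ₀.ennreal_ofReal.pow hp.measurable) measurable_const
  · by_cases hx : 0 < ρ₀ x <;> simp [hwdef, hx, ENNReal.rpow_eq_zero_iff]
  · by_cases hx : 0 < ρ₀ x <;> simp [hwdef, hx, ENNReal.rpow_eq_top_iff]
  · unfold MuckenhouptLike at hM
    obtain ⟨A, hA, -⟩ := ENNReal.lt_iff_exists_coe.1 hM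
    refine ⟨A, fun x r hr => ?_⟩
    have hle := le_iSup_of_le (f := fun x => ⨆ (r : ℝ) (_ : 0 < r),
      ((μ (qball d x r))⁻¹ * ∫⁻ y in qball d x r, ENNReal.ofReal (ρ y) ^ p y ∂μ) *
      ((μ (qball d x r))⁻¹ * ∫⁻ y in qball d x r,
        (ENNReal.ofReal (ρ y) ^ (p y / (pMinus p - 1)))⁻¹ ∂μ) ^ (pMinus p - 1)) x
      (le_iSup₂_of_le r hr le_rfl)
    rw [hA] at hle
    have h0 := (h.measure_ball_pos x r hr).ne'
    have ht := (h.measure_ball_lt_top x r hr).ne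
    rw [hint, hdual]
    set V := μ (qball d x r)
    set a := ∫⁻ y in qball d x r, ENNReal.ofReal (ρ y) ^ p y ∂μ
    set b := ∫⁻ y in qball d x r, (ENNReal.ofReal (ρ y) ^ (p y / (pMinus p - 1)))⁻¹ ∂μ
    calc a * b ^ (pMinus p - 1)
        = (V * (V⁻¹ * a)) * (V * (V⁻¹ * b)) ^ (pMinus p - 1) := by
          rw [← mul_assoc V, ← mul_assoc V, ENNReal.mul_inv_cancel h0 ht, one_mul, one_mul]
      _ = (V⁻¹ * a) * (V⁻¹ * b) ^ (pMinus p - 1) * V ^ pMinus p := by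
          rw [ENNReal.mul_rpow_of_nonneg V _ hq1.le, rpow_eq_mul_rpow_sub_one V hq.le]; ring
      _ ≤ _ := by gcongr

/-- Boundedness of the maximal operator for weights of the class `Ã`. -/
theorem maximalBounded_of_muckenhouptLike (h : IsDoublingSpace d μ) (hb : IsBoundedSpace d)
    (hp : IsExponent d p) (hρ : IsWeight μ ρ) (hM : MuckenhouptLike d μ p ρ) :
    MaximalBounded d μ p ρ := by
  have := h.isFiniteMeasure hb
  obtain ⟨w, hw, hwρ⟩ := exists_isMuckenhouptWeight h hp hρ hM
  obtain ⟨C', hC'⟩ := hw.exists_modular_bound h hb hp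
  obtain ⟨C, hC1, hC⟩ : ∃ C : ℝ≥0, 1 ≤ C ∧ ∀ g : X → ℝ≥0∞, Measurable g →
      ∫⁻ x, g x ^ p x * w x ∂μ ≤ 1 → ∫⁻ x, ballMaximal d μ g x ^ p x * w x ∂μ ≤ C :=
    ⟨max C' 1, le_max_right _ _, fun g hg hg1 => (hC' g hg hg1).trans
      (by gcongr; exact le_max_left _ _)⟩
  have hC0 : (C : ℝ≥0∞) ≠ 0 := by simpa using (zero_lt_one.trans_le hC1).ne'
  have hp0 (x : X) : 0 ≤ p x := zero_le_one.trans (hp.one_le x)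
  refine ⟨C, fun f hf => ?_⟩
  set f₀ := hf.1.mk f
  have hf₀ : Measurable f₀ := hf.1.measurable_mk
  have hff₀ : (fun x => ‖f x‖ₑ) =ᵐ[μ] fun x => ‖f₀ x‖ₑ := by
    filter_upwards [hf.1.ae_eq_mk] with x hx
    rw [hx]
  have hmax : maximal d μ f = ballMaximal d μ fun x => ‖f₀ x‖ₑ :=
    ballMaximal_congr_ae (d := d) hff₀
  have hmaxm : Measurable (maximal d μ f) := by
    rw [hmax]; exact measurable_ballMaximal h.measurable_dist hf₀.enorm
  have hmod (t : ℝ≥0) (ht : 0 < t)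
      (hft : ∫⁻ x, (‖(ρ x : ℂ) * f x‖ₑ / (t : ℝ≥0∞)) ^ p x ∂μ ≤ 1) :
      ∫⁻ x, ((t : ℝ≥0∞)⁻¹ * maximal d μ f x) ^ p x * w x ∂μ ≤ C := by
    have ht0 : (t : ℝ≥0∞)⁻¹ ≠ ∞ := by simpa using ht.ne'
    have := hC (fun x => (t : ℝ≥0∞)⁻¹ * ‖f₀ x‖ₑ) (hf₀.enorm.const_mul _) ?_
    · simpa only [ballMaximal_const_mul ht0, ← hmax] using this
    · refine le_trans (le_of_eq (lintegral_congr_ae ?_)) hft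
      filter_upwards [hwρ, hff₀] with x hx1 hx2
      rw [hx1, ← hx2, ← ENNReal.mul_rpow_of_nonneg _ _ (hp0 x), enorm_mul,
        ← ofReal_norm (ρ x : ℂ), Complex.norm_real, Real.norm_of_nonneg (hρ.nonneg x),
        div_eq_mul_inv]
      congr 1
      ring
  have hfin : ∀ᵐ x ∂μ, maximal d μ f x < ∞ := by
    have hf2 : luxNorm μ p (fun x => (ρ x : ℂ) * f x) < ∞ := hf.2
    simp only [luxNorm, iInf_lt_iff] at hf2
    obtain ⟨t, ht, hft, -⟩ := hf2
    have hm : Measurable fun x => ((t : ℝ≥0∞)⁻¹ * maximal d μ f x) ^ p x * w x :=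
      ((hmaxm.const_mul _).pow hp.measurable).mul hw.measurable
    have hlt := ae_lt_top hm ((hmod t ht hft).trans_lt ENNReal.coe_lt_top).ne
    filter_upwards [hlt] with x hx
    refine lt_top_iff_ne_top.2 fun htop => hx.ne ?_
    rw [htop, ENNReal.mul_top (by simp),
      ENNReal.top_rpow_of_pos (zero_lt_one.trans_le (hp.one_le x)),
      ENNReal.top_mul (hw.ne_zero x)]
  have hnorm : weightedNorm μ p ρ (fun x => ((maximal d μ f x).toReal : ℂ)) ≤
      C * weightedNorm μ p ρ f := by
    rw [mul_comm, ← ENNReal.div_le_iff hC0 ENNReal.coe_ne_top]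
    refine le_iInf fun t => le_iInf fun ht => le_iInf fun hft => ?_
    rw [ENNReal.div_le_iff hC0 ENNReal.coe_ne_top, ← ENNReal.coe_mul]
    have htC : 0 < t * C := mul_pos ht (zero_lt_one.trans_le hC1)
    refine iInf_le_of_le (t * C) (iInf_le_of_le htC (iInf_le_of_le ?_ le_rfl))
    have hCinv : (C : ℝ≥0∞)⁻¹ ≤ 1 := ENNReal.inv_le_one.2 (by exact_mod_cast hC1)
    calc ∫⁻ x, (‖(ρ x : ℂ) * ((maximal d μ f x).toReal : ℂ)‖ₑ / ((t * C : ℝ≥0) : ℝ≥0∞)) ^ p x ∂μ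
        ≤ ∫⁻ x, (C : ℝ≥0∞)⁻¹ * (((t : ℝ≥0∞)⁻¹ * maximal d μ f x) ^ p x * w x) ∂μ := by
          refine lintegral_mono_ae ?_
          filter_upwards [hfin, hwρ] with x hx hx1
          have he : ‖(ρ x : ℂ) * ((maximal d μ f x).toReal : ℂ)‖ₑ / ((t * C : ℝ≥0) : ℝ≥0∞) =
              (C : ℝ≥0∞)⁻¹ * ((t : ℝ≥0∞)⁻¹ * maximal d μ f x * ENNReal.ofReal (ρ x)) := by
            rw [enorm_mul, ← ofReal_norm (ρ x : ℂ), Complex.norm_real,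
              Real.norm_of_nonneg (hρ.nonneg x),
              ← ofReal_norm ((maximal d μ f x).toReal : ℂ), Complex.norm_real,
              Real.norm_of_nonneg ENNReal.toReal_nonneg, ENNReal.ofReal_toReal hx.ne,
              ENNReal.coe_mul, div_eq_mul_inv,
              ENNReal.mul_inv (Or.inr ENNReal.coe_ne_top) (Or.inl ENNReal.coe_ne_top)]
            ring
          rw [he, ENNReal.mul_rpow_of_nonneg _ _ (hp0 x),
            ENNReal.mul_rpow_of_nonneg _ (ENNReal.ofReal (ρ x)) (hp0 x), hx1]
          gcongr
          calc (C : ℝ≥0∞)⁻¹ ^ p x ≤ (C : ℝ≥0∞)⁻¹ ^ (1 : ℝ) :=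
                ENNReal.rpow_le_rpow_of_exponent_ge hCinv (hp.one_le x)
            _ = _ := ENNReal.rpow_one _
      _ = (C : ℝ≥0∞)⁻¹ * ∫⁻ x, ((t : ℝ≥0∞)⁻¹ * maximal d μ f x) ^ p x * w x ∂μ :=
          lintegral_const_mul' _ _ (ENNReal.inv_ne_top.2 hC0)
      _ ≤ (C : ℝ≥0∞)⁻¹ * C := by gcongr; exact hmod t ht hft
      _ = 1 := ENNReal.inv_mul_cancel hC0 ENNReal.coe_ne_top
  refine ⟨hfin, ⟨?_, hnorm.trans_lt (ENNReal.mul_lt_top ENNReal.coe_lt_top hf.2)⟩, hnorm⟩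
  exact (Complex.measurable_ofReal.comp hmaxm.ennreal_toReal).aemeasurable

end VariableExponent

end VarExp

theorem theoremA {X : Type*} [MeasurableSpace X] (d : X → X → ℝ) (μ : MeasureTheory.Measure X)
    (hX : VarExp.IsDoublingSpace d μ) (hb : VarExp.IsBoundedSpace d)
    (p : X → ℝ) (hp : VarExp.IsExponent d p) :
    (∀ ρ : X → ℝ, VarExp.IsWeight μ ρ → VarExp.MuckenhouptLike d μ p ρ →
      VarExp.MaximalBounded d μ p ρ) ∧
    VarExp.tildeA d μ p ⊆ VarExp.classA d μ p :=
  ⟨fun _ hρ hM => VarExp.maximalBounded_of_muckenhouptLike hX hb hp hρ hM,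
    fun _ hρ => ⟨hρ.1, VarExp.maximalBounded_of_muckenhouptLike hX hb hp hρ.1 hρ.2⟩⟩
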